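/- Let $\mathbb K$ be $\mathbb R$ or $\mathbb C$ and let $-\infty\le\alpha<\beta\le+\infty$. Let $(P_n(x))_{n\ge 0}$ be a C-finite sequence of polynomials in $\mathbb K[x]$: there are a positive integer $L$ and polynomials $p_1(x),\dots,p_L(x)\in\mathbb K[x]$ such that $$P_n(x)=\sum_{i=1}^{L}p_i(x)\,P_{n-i}(x)\qquad\text{for all } n\ge L,$$ with arbitrary initial polynomials $P_0,\dots,P_{L-1}$. Let $K:\mathbb R\to\mathbb K$ be a kernel that is holonomic on the open interval $(\alpha,\beta)$: there are $r\ge 0$ and polynomials $c_0,\dots,c_r\in\mathbb K[x]$ with $c_r\ne 0$ such that at every $x\in(\alpha,\beta)$ with $c_r(x)\neq 0$ the function $K$ is $r$ times continuously differentiable near $x$ and $$c_r(x)K^{(r)}(x)+\dots+c_1(x)K'(x)+c_0(x)K(x)=0 .$$ (The hyperexponential case, $K'/K$ a rational function, is $r=1$.) Assume that $P_n(x)K(x)$ is (absolutely) integrable on $(\alpha,\beta)$ for every $n\ge 0$, and put $$a(n)=\int_\alpha^\beta P_n(x)K(x)\,dx,\qquad f(t)=\sum_{n=0}^\infty a(n)\,t^n\in\mathbb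 K[[t]].$$ Then: 1. The formal power series $f$ satisfies a (possibly inhomogeneous) linear differential equation with polynomial coefficients and rational right-hand side: there are $d\ge 1$, polynomials $b_0,\dots,b_d\in\mathbb K[t]$ with $b_d\neq0$, and a rational function $g\in\mathbb K(t)$ such that $$b_d(t)f^{(d)}(t)+\dots+b_1(t)f'(t)+b_0(t)f(t)=g(t).$$ 2. The sequence $a(n)$ is P-recursive: there are $d\ge1$ and polynomials $s_0,\dots,s_d\in\mathbb K[n]$ with $s_d\ne0$ such that $$s_d(n)\,a(n+d)+\dots+s_1(n)\,a(n+1)+s_0(n)\,a(n)=0\qquad\text{for all } n\ge0 .$$ -/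

import Mathlib

open MeasureTheory

/-- A sequence of polynomials `P n` is C-finite: for some positive order `L` and polynomials
`p 1, …, p L` (in `x`), `P n = ∑_{i=1}^{L} p i * P (n - i)` for all `n ≥ L`.
The initial polynomials `P 0, …, P (L - 1)` are arbitrary. -/
def IsCFinite {𝕜 : Type*} [Field 𝕜] (P : ℕ → Polynomial 𝕜) : Prop :=
  ∃ (L : ℕ) (p : ℕ → Polynomial 𝕜), 0 < L ∧
    ∀ n, L ≤ n → P n = ∑ i ∈ Finset.Icc 1 L, p i * P (n - i)

/-- `K` is holonomic (D-finite) on the set `I` of reals: it satisfies a linear differential equation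
`c r * K^(r) + ⋯ + c 1 * K' + c 0 * K = 0` with polynomial coefficients and nonzero leading
coefficient `c r`, at every point of `I` that is not a singular point of the equation (a zero of
`c r`). Order `r = 1` is the hyperexponential case, where `K' / K` is a rational function. -/
def IsHolonomicOn {𝕜 : Type*} [RCLike 𝕜] (K : ℝ → 𝕜) (I : Set ℝ) : Prop :=
  ∃ (r : ℕ) (c : ℕ → Polynomial 𝕜), c r ≠ 0 ∧
    ∀ x ∈ I, (c r).eval (x : 𝕜) ≠ 0 →
      ContDiffAt ℝ r K x ∧
        ∑ i ∈ Finset.range (r + 1), (c i).eval (x : 𝕜) * iteratedDeriv i K x = 0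

/-- The formal power series `f` satisfies a linear differential equation of order `d ≥ 1`
`b d * f^(d) + ⋯ + b 1 * f' + b 0 * f = g` with polynomial coefficients, `b d ≠ 0`, and with a
rational function `g` as right-hand side. (The equation is read among Laurent series, which contain
both the power series and the rational functions.) -/
def SatisfiesInhomogeneousODE {𝕜 : Type*} [Field 𝕜] (f : PowerSeries 𝕜) : Prop :=
  ∃ (d : ℕ) (b : ℕ → Polynomial 𝕜) (g : RatFunc 𝕜), 0 < d ∧ b d ≠ 0 ∧
    ((∑ i ∈ Finset.range (d + 1),
        (b i : PowerSeries 𝕜) * (PowerSeries.derivative 𝕜)^[i] f : PowerSeries 𝕜) :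
          LaurentSeries 𝕜) = (g : LaurentSeries 𝕜)

/-- The sequence `a` is P-recursive: it satisfies a homogeneous linear recurrence of order `d ≥ 1`
`s d (n) * a (n + d) + ⋯ + s 0 (n) * a n = 0` for all `n`, with polynomial coefficients and
`s d ≠ 0`. -/
def IsPRecursive {𝕜 : Type*} [Field 𝕜] (a : ℕ → 𝕜) : Prop :=
  ∃ (d : ℕ) (s : ℕ → Polynomial 𝕜), 0 < d ∧ s d ≠ 0 ∧
    ∀ n : ℕ, ∑ j ∈ Finset.range (d + 1), (s j).eval (n : 𝕜) * a (n + j) = 0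

/-- The open real interval `(α, β)` with endpoints in `[-∞, ∞]`. -/
def realInterval (α β : EReal) : Set ℝ := {x : ℝ | α < (x : EReal) ∧ (x : EReal) < β}

/-! The integral is treated as a linear functional `M` on polynomials. Two facts about it suffice.

Analytic half: `M` kills the image of a nonzero differential operator with polynomial coefficients,
namely an adjoint of the equation for `K` (`exists_annihilated_functional`). Boundary terms and
singular points are removed by putting a high power of a real polynomial `s` in front, where `s`
vanishes at the finite endpoints and at the zeros of the leading coefficient. Integration by parts
is done against compactly supported cutoffs built from `s`, and dominated convergence removes them
(`integral_adjoint_eq_zero`). If the `P n` have bounded degree, the equation for `K` is replaced by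
an algebraic choice of `M`.

Algebraic half: the generating function `F` of `P` is rational in `x` and `t`, and `M`, applied
coefficientwise, sends it to `f`. `exists_telescoper` is a dimension count in the style of Lipshitz.
The functionals `z ↦ M (t^i * (∂_t^j F) * ∂_x^k z)` with `i, j, k ≤ n` are cubic in number, but
integration by parts and reduction by the killed operator put them in a space of dimension quadratic
in `n`. A linear relation among them, tested on a suitable power of `x`, becomes a differential
operator in `t` that kills `f`.

Reading that operator as an equation gives claim 1 (`satisfiesInhomogeneousODE_of_diffOp`), with
right-hand side zero; reading it coefficientwise gives claim 2 (`isPRecursive_of_diffOp`). -/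

/-! ### Degree bookkeeping for polynomials, rational functions and differential operators. -/

section Lipshitz

variable {𝕜 R V : Type*} [Field 𝕜] [CommRing R] [Algebra 𝕜 R] [AddCommGroup V] [Module 𝕜 V]

/-- The span of the monomials `X ^ a * T ^ b` with `a, b ≤ m`. -/
def polySpan (𝕜 : Type*) {R : Type*} [Field 𝕜] [CommRing R] [Algebra 𝕜 R] (X T : R) (m : ℕ) :
    Submodule 𝕜 R :=
  Submodule.span 𝕜 {z | ∃ a b : ℕ, a ≤ m ∧ b ≤ m ∧ z = X ^ a * T ^ b}

theorem monomial_mem_polySpan (X T : R) {a b m : ℕ} (ha : a ≤ m) (hb : b ≤ m) :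
    X ^ a * T ^ b ∈ polySpan 𝕜 X T m :=
  Submodule.subset_span ⟨a, b, ha, hb, rfl⟩

theorem one_mem_polySpan (X T : R) (m : ℕ) : (1 : R) ∈ polySpan 𝕜 X T m := by
  simpa using monomial_mem_polySpan (𝕜 := 𝕜) X T (Nat.zero_le m) (Nat.zero_le m)

theorem mul_mem_polySpan (X T : R) {m n : ℕ} {p q : R} (hp : p ∈ polySpan 𝕜 X T m)
    (hq : q ∈ polySpan 𝕜 X T n) : p * q ∈ polySpan 𝕜 X T (m + n) := by
  have h := Submodule.mul_mem_mul hp hq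
  rw [polySpan, polySpan, Submodule.span_mul_span] at h
  refine Submodule.span_mono ?_ h
  rintro _ ⟨_, ⟨a, b, ha, hb, rfl⟩, _, ⟨a', b', ha', hb', rfl⟩, rfl⟩
  exact ⟨a + a', b + b', by omega, by omega, by simp only []; ring⟩

theorem derivation_mem_polySpan (X T : R) (d : Derivation 𝕜 R R) (hX : d X ∈ polySpan 𝕜 X T 0)
    (hT : d T ∈ polySpan 𝕜 X T 0) {m : ℕ} {p : R} (hp : p ∈ polySpan 𝕜 X T m) :
    d p ∈ polySpan 𝕜 X T m := by
  induction hp using Submodule.span_induction with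
  | zero => simp
  | add x y _ _ hx hy => rw [map_add]; exact add_mem hx hy
  | smul c x _ hx => rw [d.map_smul]; exact Submodule.smul_mem _ _ hx
  | mem x hx =>
    obtain ⟨a, b, ha, hb, rfl⟩ := hx
    have h1 : X ^ (a - 1) * T ^ b * d X ∈ polySpan 𝕜 X T (m + 0) :=
      mul_mem_polySpan X T (monomial_mem_polySpan X T (by omega) hb) hX
    have h2 : X ^ a * T ^ (b - 1) * d T ∈ polySpan 𝕜 X T (m + 0) :=
      mul_mem_polySpan X T (monomial_mem_polySpan X T ha (by omega)) hT
    have h : d (X ^ a * T ^ b) = b • (X ^ a * T ^ (b - 1) * d T) +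
        a • (X ^ (a - 1) * T ^ b * d X) := by
      simp only [Derivation.leibniz, Derivation.leibniz_pow, smul_eq_mul, nsmul_eq_mul]
      ring
    rw [h]
    exact add_mem (Submodule.smul_of_tower_mem _ _ h2) (Submodule.smul_of_tower_mem _ _ h1)

/-- The elements `β ^ k * p`, with `p` in the span of the monomials of degrees at most `m * k`. -/
def ratSpan (𝕜 : Type*) {R : Type*} [Field 𝕜] [CommRing R] [Algebra 𝕜 R] (X T β : R) (m k : ℕ) :
    Submodule 𝕜 R :=
  (polySpan 𝕜 X T (m * k)).map (LinearMap.mulLeft 𝕜 (β ^ k))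

theorem mem_ratSpan {X T β : R} {m k : ℕ} {z : R} :
    z ∈ ratSpan 𝕜 X T β m k ↔ ∃ p ∈ polySpan 𝕜 X T (m * k), β ^ k * p = z := by
  simp [ratSpan]

/-- Here `β` stands for `1 / B`, and `p / B^k = p B / B^(k+1)`: each unit of `k` pays for `m` more
degrees in each variable. -/
theorem ratSpan_succ {X T β B : R} {m : ℕ} (hB : B ∈ polySpan 𝕜 X T m) (hβ : β * B = 1) :
    Monotone (ratSpan 𝕜 X T β m) := by
  refine monotone_nat_of_le_succ fun k z hz => ?_
  obtain ⟨p, hp, rfl⟩ := mem_ratSpan.1 hz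
  refine mem_ratSpan.2 ⟨p * B, ?_, ?_⟩
  · rw [mul_add_one]; exact mul_mem_polySpan X T hp hB
  · linear_combination β ^ k * p * hβ

/-- The quotient rule: `d (p / B^k) = (B * d p - k * p * d B) / B^(k+1)`, so a derivative costs one
unit of `k`. -/
theorem derivation_mem_ratSpan {X T β B : R} {m : ℕ} (hB : B ∈ polySpan 𝕜 X T m) (hβ : β * B = 1)
    (d : Derivation 𝕜 R R) (hX : d X ∈ polySpan 𝕜 X T 0) (hT : d T ∈ polySpan 𝕜 X T 0) {k : ℕ}
    {z : R} (hz : z ∈ ratSpan 𝕜 X T β m k) : d z ∈ ratSpan 𝕜 X T β m (k + 1) := by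
  obtain ⟨p, hp, rfl⟩ := mem_ratSpan.1 hz
  have hd : d β = -β ^ 2 * d B := by
    have := d.leibniz_of_mul_eq_one hβ
    simpa using this
  refine mem_ratSpan.2 ⟨d p * B - k • (p * d B), ?_, ?_⟩
  · rw [mul_add_one]
    exact sub_mem (mul_mem_polySpan X T (derivation_mem_polySpan X T d hX hT hp) hB)
      (Submodule.smul_of_tower_mem _ _
        (mul_mem_polySpan X T hp (derivation_mem_polySpan X T d hX hT hB)))
  · rw [Derivation.leibniz, Derivation.leibniz_pow, hd]
    simp only [smul_eq_mul, nsmul_eq_mul]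
    rcases k with _ | k
    · simp; linear_combination d p * hβ
    · simp only [Nat.add_sub_cancel]
      linear_combination β ^ (k + 1) * d p * hβ

theorem T_mul_mem_ratSpan {X T β B : R} {m : ℕ} (hB : T * B ∈ polySpan 𝕜 X T m)
    (hβ : β * B = 1) {k : ℕ} {z : R} (hz : z ∈ ratSpan 𝕜 X T β m k) :
    T * z ∈ ratSpan 𝕜 X T β m (k + 1) := by
  obtain ⟨p, hp, rfl⟩ := mem_ratSpan.1 hz
  refine mem_ratSpan.2 ⟨p * (T * B), ?_, ?_⟩
  · rw [mul_add_one]; exact mul_mem_polySpan X T hp hB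
  · linear_combination T * β ^ k * p * hβ

/-- The span of the operators `z ↦ d^l (h z)` with `l < k` and `h ∈ S`. -/
def opSpan (d : Derivation 𝕜 R R) (S : Submodule 𝕜 R) (k : ℕ) : Submodule 𝕜 (Module.End 𝕜 R) :=
  Submodule.span 𝕜 {A | ∃ l < k, ∃ h ∈ S, A = (d : R →ₗ[𝕜] R) ^ l * LinearMap.mulLeft 𝕜 h}

theorem opSpan_mono (d : Derivation 𝕜 R R) {S S' : Submodule 𝕜 R} (hS : S ≤ S') {k k' : ℕ}
    (hk : k ≤ k') : opSpan d S k ≤ opSpan d S' k' := by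
  apply Submodule.span_mono
  rintro A ⟨l, hl, h, hh, rfl⟩
  exact ⟨l, hl.trans_le hk, h, hS hh, rfl⟩

theorem mem_opSpan (d : Derivation 𝕜 R R) {S : Submodule 𝕜 R} {l k : ℕ} (hl : l < k) {h : R}
    (hh : h ∈ S) : (d : R →ₗ[𝕜] R) ^ l * LinearMap.mulLeft 𝕜 h ∈ opSpan d S k :=
  Submodule.subset_span ⟨l, hl, h, hh, rfl⟩

theorem derivation_mul_mem_opSpan (d : Derivation 𝕜 R R) {S : Submodule 𝕜 R} {k : ℕ}
    {A : Module.End 𝕜 R} (hA : A ∈ opSpan d S k) :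
    (d : R →ₗ[𝕜] R) * A ∈ opSpan d S (k + 1) := by
  have h : opSpan d S k ≤ (opSpan d S (k + 1)).comap (LinearMap.mulLeft 𝕜 (d : R →ₗ[𝕜] R)) := by
    refine Submodule.span_le.2 ?_
    rintro _ ⟨l, hl, h, hh, rfl⟩
    simp only [SetLike.mem_coe, Submodule.mem_comap, LinearMap.mulLeft_apply, ← mul_assoc,
      ← pow_succ']
    exact mem_opSpan d (by omega) hh
  exact h hA

/-- Moving a multiplication past a power of a derivation, along an increasing chain of subspaces
which the derivation respects. -/
theorem mulLeft_mul_derivation_pow (d : Derivation 𝕜 R R) (S : ℕ → Submodule 𝕜 R) (hS : Monotone S)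
    (hd : ∀ j, ∀ g ∈ S j, d g ∈ S (j + 1)) (k : ℕ) : ∀ j, ∀ g ∈ S j,
    LinearMap.mulLeft 𝕜 g * (d : R →ₗ[𝕜] R) ^ k - (d : R →ₗ[𝕜] R) ^ k * LinearMap.mulLeft 𝕜 g ∈
      opSpan d (S (j + k)) k := by
  induction k with
  | zero => intro j g _; simp
  | succ k ih =>
    intro j g hg
    -- Leibniz rule read as a commutation relation; iterating it moves every multiplication to the
    -- right of the derivatives.
    have h1 : LinearMap.mulLeft 𝕜 g * (d : R →ₗ[𝕜] R) =
        (d : R →ₗ[𝕜] R) * LinearMap.mulLeft 𝕜 g - LinearMap.mulLeft 𝕜 (d g) := by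
      ext z
      simp [Derivation.leibniz, mul_comm]
    have h2 : LinearMap.mulLeft 𝕜 g * (d : R →ₗ[𝕜] R) ^ (k + 1) -
          (d : R →ₗ[𝕜] R) ^ (k + 1) * LinearMap.mulLeft 𝕜 g =
        (d : R →ₗ[𝕜] R) * (LinearMap.mulLeft 𝕜 g * (d : R →ₗ[𝕜] R) ^ k -
          (d : R →ₗ[𝕜] R) ^ k * LinearMap.mulLeft 𝕜 g) -
        (LinearMap.mulLeft 𝕜 (d g) * (d : R →ₗ[𝕜] R) ^ k -
          (d : R →ₗ[𝕜] R) ^ k * LinearMap.mulLeft 𝕜 (d g)) -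
        (d : R →ₗ[𝕜] R) ^ k * LinearMap.mulLeft 𝕜 (d g) := by
      rw [pow_succ', ← mul_assoc, h1]
      simp only [sub_mul, mul_sub, mul_assoc]
      abel
    rw [h2]
    have e : j + 1 + k = j + (k + 1) := by ring
    refine sub_mem (sub_mem ?_ ?_) ?_
    · exact opSpan_mono d (hS (by omega)) le_rfl (derivation_mul_mem_opSpan d (ih j g hg))
    · have := ih (j + 1) (d g) (hd j g hg)
      rw [e] at this
      exact opSpan_mono d le_rfl (by omega) this
    · exact mem_opSpan d (by omega) (hS (by omega) (hd j g hg))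

/-- Polynomial expressions in `X` of degree at most `n`. -/
noncomputable def degSpan (𝕜 : Type*) {R : Type*} [Field 𝕜] [CommRing R] [Algebra 𝕜 R] (X : R) (n : ℕ) :
    Submodule 𝕜 R :=
  (Polynomial.degreeLE 𝕜 n).map (Polynomial.aeval X).toLinearMap

theorem mem_degSpan {X : R} {n : ℕ} {z : R} :
    z ∈ degSpan 𝕜 X n ↔ ∃ p : Polynomial 𝕜, p.natDegree ≤ n ∧ Polynomial.aeval X p = z := by
  simp [degSpan, Polynomial.mem_degreeLE, Polynomial.natDegree_le_iff_degree_le]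

theorem derivation_mem_degSpan {d : Derivation 𝕜 R R} {X : R} (hX : d X = 1) {n : ℕ} {z : R}
    (hz : z ∈ degSpan 𝕜 X n) : d z ∈ degSpan 𝕜 X n := by
  obtain ⟨p, hp, rfl⟩ := mem_degSpan.1 hz
  refine mem_degSpan.2 ⟨Polynomial.derivative p, ?_, ?_⟩
  · exact (Polynomial.natDegree_derivative_le p).trans (by omega)
  · simp [Derivation.map_aeval, hX]

theorem mul_mem_degSpan {X : R} {m n : ℕ} {y z : R} (hy : y ∈ degSpan 𝕜 X m)
    (hz : z ∈ degSpan 𝕜 X n) : y * z ∈ degSpan 𝕜 X (m + n) := by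
  obtain ⟨p, hp, rfl⟩ := mem_degSpan.1 hy
  obtain ⟨q, hq, rfl⟩ := mem_degSpan.1 hz
  exact mem_degSpan.2 ⟨p * q, Polynomial.natDegree_mul_le.trans (by omega), by simp⟩

/-- The functionals `z ↦ M (d^l (X^a z))` with `l < r`, `a ≤ N` or with `l ≤ n`, `a < m`. -/
def basicFunctionals (d : Derivation 𝕜 R R) (X : R) (M : R →ₗ[𝕜] V) (r m n N : ℕ) :
    Set (R →ₗ[𝕜] V) :=
  (fun la : ℕ × ℕ => M ∘ₗ ((d : R →ₗ[𝕜] R) ^ la.1 * LinearMap.mulLeft 𝕜 (X ^ la.2))) ''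
    ((Finset.range r ×ˢ Finset.range (N + 1) ∪ Finset.range (n + 1) ×ˢ Finset.range m :
      Finset (ℕ × ℕ)) : Set (ℕ × ℕ))

theorem comp_mulLeft_aeval_mem (d : Derivation 𝕜 R R) (X : R) (M : R →ₗ[𝕜] V) (l : ℕ)
    (W : Submodule 𝕜 (R →ₗ[𝕜] V)) (p : Polynomial 𝕜)
    (hW : ∀ a ≤ p.natDegree,
      M ∘ₗ ((d : R →ₗ[𝕜] R) ^ l * LinearMap.mulLeft 𝕜 (X ^ a)) ∈ W) :
    M ∘ₗ ((d : R →ₗ[𝕜] R) ^ l * LinearMap.mulLeft 𝕜 (Polynomial.aeval X p)) ∈ W := by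
  have h : M ∘ₗ ((d : R →ₗ[𝕜] R) ^ l * LinearMap.mulLeft 𝕜 (Polynomial.aeval X p)) =
      ∑ a ∈ Finset.range (p.natDegree + 1), p.coeff a •
        M ∘ₗ ((d : R →ₗ[𝕜] R) ^ l * LinearMap.mulLeft 𝕜 (X ^ a)) := by
    ext z
    simp [Polynomial.aeval_eq_sum_range, Finset.sum_mul]
  rw [h]
  exact Submodule.sum_mem _ fun a ha => Submodule.smul_mem _ _
    (hW a (Nat.lt_succ_iff.1 (Finset.mem_range.1 ha)))

/-- If `M` kills the image of a differential operator of order `r` with polynomial coefficients of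
degree at most `C` and leading coefficient of degree `m`, then every functional
`z ↦ M (d^l (p(X) z))` reduces to basic ones. -/
theorem comp_mem_span_basicFunctionals {d : Derivation 𝕜 R R} {X : R} (hX : d X = 1)
    (M : R →ₗ[𝕜] V) {r C : ℕ} {c : ℕ → Polynomial 𝕜} (hc : c r ≠ 0)
    (hC : ∀ i ≤ r, (c i).natDegree ≤ C)
    (hM : ∀ z, M (∑ i ∈ Finset.range (r + 1),
      ((d : R →ₗ[𝕜] R) ^ i) (Polynomial.aeval X (c i) * z)) = 0)
    {n N : ℕ} (l : ℕ) (hl : l ≤ n) : ∀ D, D + C * l ≤ N → ∀ p ∈ degSpan 𝕜 X D,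
      M ∘ₗ ((d : R →ₗ[𝕜] R) ^ l * LinearMap.mulLeft 𝕜 p) ∈
        Submodule.span 𝕜 (basicFunctionals d X M r (c r).natDegree n N) := by
  induction l using Nat.strong_induction_on with
  | _ l ih =>
  intro D hD p hp
  obtain ⟨p, hpD, rfl⟩ := mem_degSpan.1 hp
  rcases lt_or_ge l r with hlr | hlr
  · refine comp_mulLeft_aeval_mem d X M l _ p fun a ha => Submodule.subset_span ?_
    refine ⟨(l, a), ?_, rfl⟩
    have := Nat.le_add_right D (C * l)
    simp only [Finset.coe_union, Set.mem_union, Finset.mem_coe, Finset.mem_product,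
      Finset.mem_range]
    left; constructor <;> omega
  obtain ⟨v, rfl⟩ := Nat.exists_eq_add_of_le hlr
  set W := Submodule.span 𝕜 (basicFunctionals d X M r (c r).natDegree n N)
  -- Euclidean division by the leading coefficient: the remainder has degree below that of `c r`,
  -- hence gives basic functionals, and the multiple of `c r` can be traded for lower orders.
  set Q := p / c r
  have hp : p = c r * Q + p % c r := (EuclideanDomain.div_add_mod p (c r)).symm
  have hQ : Q.natDegree ≤ D :=
    (Polynomial.natDegree_le_natDegree (Polynomial.degree_div_le p (c r))).trans hpD
  have hrem : M ∘ₗ ((d : R →ₗ[𝕜] R) ^ (r + v) *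
      LinearMap.mulLeft 𝕜 (Polynomial.aeval X (p % c r))) ∈ W := by
    by_cases h0 : p % c r = 0
    · simp [h0]
    refine comp_mulLeft_aeval_mem d X M _ _ _ fun a ha => Submodule.subset_span ?_
    have : (p % c r).natDegree < (c r).natDegree :=
      Polynomial.natDegree_lt_natDegree h0 (EuclideanDomain.mod_lt p hc)
    refine ⟨(r + v, a), ?_, rfl⟩
    simp only [Finset.coe_union, Set.mem_union, Finset.mem_coe, Finset.mem_product,
      Finset.mem_range]
    right; constructor <;> omega
  -- Lowering the order by one frees `C` degrees in the budget `D + C * l ≤ N`, exactly what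
  -- multiplication by a `c i` or its derivatives may add.
  have hlow : ∀ l' < r + v, ∀ h ∈ degSpan 𝕜 X (C + D),
      M ∘ₗ ((d : R →ₗ[𝕜] R) ^ l' * LinearMap.mulLeft 𝕜 h) ∈ W := by
    intro l' hl' h hh
    refine ih l' hl' (by omega) (C + D) ?_ h hh
    have : C * (l' + 1) ≤ C * (r + v) := Nat.mul_le_mul_left C hl'
    rw [mul_add_one] at this
    omega
  have hcomm : ∀ i ≤ r, M ∘ₗ ((d : R →ₗ[𝕜] R) ^ i *
      (LinearMap.mulLeft 𝕜 (Polynomial.aeval X (c i)) * (d : R →ₗ[𝕜] R) ^ v -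
        (d : R →ₗ[𝕜] R) ^ v * LinearMap.mulLeft 𝕜 (Polynomial.aeval X (c i))) *
          LinearMap.mulLeft 𝕜 (Polynomial.aeval X Q)) ∈ W := by
    intro i hi
    have h1 := mulLeft_mul_derivation_pow d (fun _ => degSpan 𝕜 X C) monotone_const
      (fun _ g hg => derivation_mem_degSpan hX hg) v 0 (Polynomial.aeval X (c i))
      (mem_degSpan.2 ⟨c i, hC i hi, rfl⟩)
    generalize LinearMap.mulLeft 𝕜 (Polynomial.aeval X (c i)) * (d : R →ₗ[𝕜] R) ^ v -
      (d : R →ₗ[𝕜] R) ^ v * LinearMap.mulLeft 𝕜 (Polynomial.aeval X (c i)) = A at h1 ⊢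
    induction h1 using Submodule.span_induction with
    | zero => simp
    | add x y _ _ hx hy =>
      rw [mul_add, add_mul, LinearMap.comp_add]
      exact add_mem hx hy
    | smul e x _ hx =>
      rw [mul_smul_comm, smul_mul_assoc, LinearMap.comp_smul]
      exact Submodule.smul_mem _ _ hx
    | mem x hx =>
      obtain ⟨l', hl', h, hh, rfl⟩ := hx
      have := hlow (i + l') (by omega) (h * Polynomial.aeval X Q)
        (mul_mem_degSpan hh (mem_degSpan.2 ⟨Q, hQ, rfl⟩))
      rw [pow_add, LinearMap.mulLeft_mul] at this
      exact this
  -- This is `hM` applied to `d^v (Q z)`: each `c i` is moved past `d^v` at the price of a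
  -- commutator, and the term `i = r` is isolated.
  have key : M ∘ₗ ((d : R →ₗ[𝕜] R) ^ (r + v) *
      LinearMap.mulLeft 𝕜 (Polynomial.aeval X (c r * Q))) =
      -∑ i ∈ Finset.range (r + 1), M ∘ₗ ((d : R →ₗ[𝕜] R) ^ i *
      (LinearMap.mulLeft 𝕜 (Polynomial.aeval X (c i)) * (d : R →ₗ[𝕜] R) ^ v -
        (d : R →ₗ[𝕜] R) ^ v * LinearMap.mulLeft 𝕜 (Polynomial.aeval X (c i))) *
          LinearMap.mulLeft 𝕜 (Polynomial.aeval X Q)) -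
      ∑ i ∈ Finset.range r, M ∘ₗ ((d : R →ₗ[𝕜] R) ^ (i + v) *
        LinearMap.mulLeft 𝕜 (Polynomial.aeval X (c i * Q))) := by
    ext z
    have := hM (((d : R →ₗ[𝕜] R) ^ v) (Polynomial.aeval X Q * z))
    have e : ∀ i, ((d : R →ₗ[𝕜] R) ^ (i + v)) (Polynomial.aeval X (c i * Q) * z) =
        ((d : R →ₗ[𝕜] R) ^ i) (((d : R →ₗ[𝕜] R) ^ v)
          (Polynomial.aeval X (c i) * (Polynomial.aeval X Q * z))) := by
      intro i
      rw [pow_add, Module.End.mul_apply, map_mul (Polynomial.aeval X), mul_assoc]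
    simp only [LinearMap.comp_apply, LinearMap.sub_apply, LinearMap.neg_apply,
      LinearMap.sum_apply, Module.End.mul_apply, LinearMap.mulLeft_apply, map_sub, e,
      Finset.sum_sub_distrib, ← map_sum M] at this ⊢
    rw [this, Finset.sum_range_succ _ r, map_add]
    abel
  have hsplit : M ∘ₗ ((d : R →ₗ[𝕜] R) ^ (r + v) * LinearMap.mulLeft 𝕜 (Polynomial.aeval X p)) =
      M ∘ₗ ((d : R →ₗ[𝕜] R) ^ (r + v) * LinearMap.mulLeft 𝕜 (Polynomial.aeval X (c r * Q))) +
      M ∘ₗ ((d : R →ₗ[𝕜] R) ^ (r + v) *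
        LinearMap.mulLeft 𝕜 (Polynomial.aeval X (p % c r))) := by
    ext z
    conv_lhs => rw [hp]
    simp [add_mul, mul_assoc]
  rw [hsplit]
  refine add_mem ?_ hrem
  rw [key]
  refine sub_mem (neg_mem (Submodule.sum_mem _ fun i hi => hcomm i ?_))
    (Submodule.sum_mem _ fun i hi => hlow (i + v) ?_ _ ?_)
  · exact Nat.lt_succ_iff.1 (Finset.mem_range.1 hi)
  · have := Finset.mem_range.1 hi; omega
  · rw [map_mul]
    exact mul_mem_degSpan (mem_degSpan.2 ⟨c i, hC i (Finset.mem_range.1 hi).le, rfl⟩)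
      (mem_degSpan.2 ⟨Q, hQ, rfl⟩)

end Lipshitz

/-! ### Creative telescoping by a dimension count. -/

section Telescoping

variable {𝕜 R V : Type*} [Field 𝕜] [CommRing R] [Algebra 𝕜 R] [AddCommGroup V] [Module 𝕜 V]

theorem derivation_pow_mul_of_eq_zero {d : Derivation 𝕜 R R} {T : R} (hT : d T = 0) (b l : ℕ)
    (z : R) : ((d : R →ₗ[𝕜] R) ^ l) (T ^ b * z) = T ^ b * ((d : R →ₗ[𝕜] R) ^ l) z := by
  induction l with
  | zero => simp
  | succ l ih =>
    rw [pow_succ', Module.End.mul_apply, Module.End.mul_apply, ih]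
    simp [Derivation.leibniz, Derivation.leibniz_pow, hT]

theorem derivation_pow_apply_pow {d : Derivation 𝕜 R R} {X : R} (hX : d X = 1) (k : ℕ) :
    ((d : R →ₗ[𝕜] R) ^ k) (X ^ k) = (k.factorial : R) := by
  have h : ∀ l n : ℕ, ((d : R →ₗ[𝕜] R) ^ l) (X ^ n) = (n.descFactorial l : R) * X ^ (n - l) := by
    intro l
    induction l with
    | zero => intro n; simp
    | succ l ih =>
      intro n
      rw [pow_succ', Module.End.mul_apply, ih]
      simp [Derivation.leibniz, Derivation.leibniz_pow, hX, Nat.descFactorial_succ, Nat.sub_sub]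
      ring
  simp [h, Nat.descFactorial_self]

theorem derivation_pow_apply_pow_of_lt {d : Derivation 𝕜 R R} {X : R} (hX : d X = 1) {k l : ℕ}
    (h : k < l) : ((d : R →ₗ[𝕜] R) ^ l) (X ^ k) = 0 := by
  obtain ⟨e, rfl⟩ := Nat.exists_eq_add_of_lt h
  rw [show k + e + 1 = e + 1 + k by ring, pow_add, Module.End.mul_apply,
    derivation_pow_apply_pow hX, pow_succ, Module.End.mul_apply]
  simp

theorem pow_apply_comm (M : R →ₗ[𝕜] V) (A : Module.End 𝕜 R) (τ : Module.End 𝕜 V)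
    (h : ∀ z, M (A z) = τ (M z)) (b : ℕ) (z : R) : M ((A ^ b) z) = (τ ^ b) (M z) := by
  induction b with
  | zero => simp
  | succ b ih => rw [pow_succ', pow_succ', Module.End.mul_apply, Module.End.mul_apply, h, ih]

theorem mulLeft_pow_apply_comm {T : R} {M : R →ₗ[𝕜] V} {τ : Module.End 𝕜 V}
    (h : ∀ z, M (T * z) = τ (M z)) (b : ℕ) (z : R) : M (T ^ b * z) = (τ ^ b) (M z) := by
  have := pow_apply_comm M (LinearMap.mulLeft 𝕜 T) τ h b z
  rwa [LinearMap.pow_mulLeft] at this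

theorem derivation_pow_mem_ratSpan {X T β B : R} {m : ℕ} (hB : B ∈ polySpan 𝕜 X T m)
    (hβ : β * B = 1) (d : Derivation 𝕜 R R) (hX : d X ∈ polySpan 𝕜 X T 0)
    (hT : d T ∈ polySpan 𝕜 X T 0) {k : ℕ} {z : R} (hz : z ∈ ratSpan 𝕜 X T β m k) (j : ℕ) :
    ((d : R →ₗ[𝕜] R) ^ j) z ∈ ratSpan 𝕜 X T β m (k + j) := by
  induction j with
  | zero => simpa
  | succ j ih =>
    rw [pow_succ', Module.End.mul_apply]
    exact derivation_mem_ratSpan hB hβ d hX hT ih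

theorem T_pow_mul_mem_ratSpan {X T β B : R} {m : ℕ} (hB : T * B ∈ polySpan 𝕜 X T m)
    (hβ : β * B = 1) {k : ℕ} {z : R} (hz : z ∈ ratSpan 𝕜 X T β m k) (i : ℕ) :
    T ^ i * z ∈ ratSpan 𝕜 X T β m (k + i) := by
  induction i with
  | zero => simpa
  | succ i ih =>
    rw [pow_succ', mul_assoc]
    exact T_mul_mem_ratSpan hB hβ ih

/-- In `h = β^K * X^a * T^b` the factors are handled separately: `T` commutes with `d` and leaves
`M` as `τ`, the power of `X` is reduced by the killed operator, and `β^K` is never expanded but kept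
as one common right factor. -/
theorem comp_mem_of_mem_ratSpan {d : Derivation 𝕜 R R} {X T : R} (hX : d X = 1) (hT : d T = 0)
    {M : R →ₗ[𝕜] V} {τ : Module.End 𝕜 V} (hτ : ∀ z, M (T * z) = τ (M z))
    {r C : ℕ} {c : ℕ → Polynomial 𝕜} (hc : c r ≠ 0) (hC : ∀ i ≤ r, (c i).natDegree ≤ C)
    (hM : ∀ z, M (∑ i ∈ Finset.range (r + 1),
      ((d : R →ₗ[𝕜] R) ^ i) (Polynomial.aeval X (c i) * z)) = 0)
    {β : R} {m n N K l : ℕ} (hl : l ≤ n) (hN : m * K + C * n ≤ N) {h : R}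
    (hh : h ∈ ratSpan 𝕜 X T β m K) :
    M ∘ₗ ((d : R →ₗ[𝕜] R) ^ l * LinearMap.mulLeft 𝕜 h) ∈ Submodule.span 𝕜
      {ψ | ∃ b ≤ m * K, ∃ φ ∈ basicFunctionals d X M r (c r).natDegree n N,
        ψ = (τ ^ b) ∘ₗ φ ∘ₗ LinearMap.mulLeft 𝕜 (β ^ K)} := by
  obtain ⟨p, hp, rfl⟩ := mem_ratSpan.1 hh
  induction hp using Submodule.span_induction with
  | zero => simp
  | add x y hx hy hx' hy' =>
    have e : LinearMap.mulLeft 𝕜 (β ^ K * (x + y)) =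
        LinearMap.mulLeft 𝕜 (β ^ K * x) + LinearMap.mulLeft 𝕜 (β ^ K * y) := by
      ext; simp; ring
    rw [e, mul_add, LinearMap.comp_add]
    exact add_mem (hx' (mem_ratSpan.2 ⟨x, hx, rfl⟩)) (hy' (mem_ratSpan.2 ⟨y, hy, rfl⟩))
  | smul e x hx hx' =>
    have e : LinearMap.mulLeft 𝕜 (β ^ K * (e • x)) = e • LinearMap.mulLeft 𝕜 (β ^ K * x) := by
      ext; simp [mul_assoc]
    rw [e, mul_smul_comm, LinearMap.comp_smul]
    exact Submodule.smul_mem _ _ (hx' (mem_ratSpan.2 ⟨x, hx, rfl⟩))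
  | mem x hx =>
    obtain ⟨a, b, ha, hb, rfl⟩ := hx
    have e : M ∘ₗ ((d : R →ₗ[𝕜] R) ^ l * LinearMap.mulLeft 𝕜 (β ^ K * (X ^ a * T ^ b))) =
        (τ ^ b) ∘ₗ (M ∘ₗ ((d : R →ₗ[𝕜] R) ^ l * LinearMap.mulLeft 𝕜 (X ^ a))) ∘ₗ
          LinearMap.mulLeft 𝕜 (β ^ K) := by
      ext z
      simp only [LinearMap.comp_apply, Module.End.mul_apply, LinearMap.mulLeft_apply]
      rw [← mulLeft_pow_apply_comm hτ, ← derivation_pow_mul_of_eq_zero hT]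
      congr 2
      ring
    rw [e]
    have h1 := comp_mem_span_basicFunctionals hX M hc hC hM (n := n) (N := N) l hl a
      (by have := Nat.mul_le_mul_left C hl; omega) (X ^ a)
      (mem_degSpan.2 ⟨Polynomial.X ^ a, by simp, by simp⟩)
    generalize M ∘ₗ ((d : R →ₗ[𝕜] R) ^ l * LinearMap.mulLeft 𝕜 (X ^ a)) = φ at h1
    induction h1 using Submodule.span_induction with
    | zero => simp
    | add x y _ _ hx hy =>
      rw [LinearMap.add_comp, LinearMap.comp_add]
      exact add_mem hx hy
    | smul e x _ hx =>
      rw [LinearMap.smul_comp, LinearMap.comp_smul]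
      exact Submodule.smul_mem _ _ hx
    | mem x hx => exact Submodule.subset_span ⟨b, hb, x, hx, rfl⟩

/-- Formal integration by parts: moving `g` to the right of `d^k` differentiates it at most `k`
times, hence the requirement `j + k ≤ K`. -/
theorem mulLeft_comp_mem {d : Derivation 𝕜 R R} {X T : R} (hX : d X = 1) (hT : d T = 0)
    {M : R →ₗ[𝕜] V} {τ : Module.End 𝕜 V} (hτ : ∀ z, M (T * z) = τ (M z))
    {r C : ℕ} {c : ℕ → Polynomial 𝕜} (hc : c r ≠ 0) (hC : ∀ i ≤ r, (c i).natDegree ≤ C)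
    (hM : ∀ z, M (∑ i ∈ Finset.range (r + 1),
      ((d : R →ₗ[𝕜] R) ^ i) (Polynomial.aeval X (c i) * z)) = 0)
    {β B : R} {m n N K k j : ℕ} (hB : B ∈ polySpan 𝕜 X T m) (hβ : β * B = 1)
    (hk : k ≤ n) (hN : m * K + C * n ≤ N) (hj : j + k ≤ K) {g : R}
    (hg : g ∈ ratSpan 𝕜 X T β m j) :
    M ∘ₗ (LinearMap.mulLeft 𝕜 g * (d : R →ₗ[𝕜] R) ^ k) ∈ Submodule.span 𝕜
      {ψ | ∃ b ≤ m * K, ∃ φ ∈ basicFunctionals d X M r (c r).natDegree n N,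
        ψ = (τ ^ b) ∘ₗ φ ∘ₗ LinearMap.mulLeft 𝕜 (β ^ K)} := by
  have hmono := ratSpan_succ hB hβ
  have h1 := mulLeft_mul_derivation_pow d (ratSpan 𝕜 X T β m) hmono
    (fun j g hg => derivation_mem_ratSpan hB hβ d (by rw [hX]; exact one_mem_polySpan X T 0)
      (by rw [hT]; exact zero_mem _) hg) k j g hg
  have h2 := comp_mem_of_mem_ratSpan hX hT hτ hc hC hM hk hN (hmono (by omega : j ≤ K) hg)
  rw [← sub_add_cancel (LinearMap.mulLeft 𝕜 g * (d : R →ₗ[𝕜] R) ^ k)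
    ((d : R →ₗ[𝕜] R) ^ k * LinearMap.mulLeft 𝕜 g), LinearMap.comp_add]
  refine add_mem ?_ h2
  generalize LinearMap.mulLeft 𝕜 g * (d : R →ₗ[𝕜] R) ^ k -
    (d : R →ₗ[𝕜] R) ^ k * LinearMap.mulLeft 𝕜 g = A at h1 ⊢
  induction h1 using Submodule.span_induction with
  | zero => simp
  | add x y _ _ hx hy =>
    rw [LinearMap.comp_add]
    exact add_mem hx hy
  | smul e x _ hx =>
    rw [LinearMap.comp_smul]
    exact Submodule.smul_mem _ _ hx
  | mem x hx =>
    obtain ⟨l, hl, h, hh, rfl⟩ := hx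
    exact comp_mem_of_mem_ratSpan hX hT hτ hc hC hM (by omega) hN (hmono hj hh)

theorem finite_basicFunctionals (d : Derivation 𝕜 R R) (X : R) (M : R →ₗ[𝕜] V) (τ : Module.End 𝕜 V)
    (ρ : Module.End 𝕜 R) (r m n N e : ℕ) : ∃ s : Finset (R →ₗ[𝕜] V),
      s.card ≤ (e + 1) * (r * (N + 1) + (n + 1) * m) ∧
      {ψ | ∃ b ≤ e, ∃ φ ∈ basicFunctionals d X M r m n N, ψ = (τ ^ b) ∘ₗ φ ∘ₗ ρ} ⊆
        (s : Set (R →ₗ[𝕜] V)) := by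
  classical
  refine ⟨(Finset.range (e + 1) ×ˢ (Finset.range r ×ˢ Finset.range (N + 1) ∪
    Finset.range (n + 1) ×ˢ Finset.range m)).image fun x => (τ ^ x.1) ∘ₗ
      (M ∘ₗ ((d : R →ₗ[𝕜] R) ^ x.2.1 * LinearMap.mulLeft 𝕜 (X ^ x.2.2))) ∘ₗ ρ, ?_, ?_⟩
  · refine Finset.card_image_le.trans ?_
    rw [Finset.card_product, Finset.card_range]
    gcongr
    refine (Finset.card_union_le _ _).trans ?_
    simp
  · rintro _ ⟨b, hb, _, ⟨la, hla, rfl⟩, rfl⟩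
    rw [Finset.coe_image]
    refine ⟨(b, la), ?_, rfl⟩
    simp only [Finset.coe_product, Set.mem_prod, Finset.mem_coe, Finset.mem_range]
    exact ⟨by omega, hla⟩

theorem not_linearIndependent_of_mem_span {W ι : Type*} [AddCommGroup W] [Module 𝕜 W] [Fintype ι]
    (E : ι → W) (s : Finset W) (hs : s.card < Fintype.card ι)
    (hE : ∀ i, E i ∈ Submodule.span 𝕜 (s : Set W)) : ¬ LinearIndependent 𝕜 E := by
  intro h
  have h1 := finrank_span_eq_card h
  have h2 : Submodule.span 𝕜 (Set.range E) ≤ Submodule.span 𝕜 (s : Set W) :=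
    Submodule.span_le.2 (by rintro _ ⟨i, rfl⟩; exact hE i)
  have h3 := Submodule.finrank_mono h2
  have h4 := finrank_span_finset_le_card (R := 𝕜) s
  unfold Set.finrank at h4
  omega

/-- The left side is at most `n * (n + 1)^2` for this `n`, which is chosen so that the constant in
front of the quadratic bound equals `n`. -/
theorem card_bound (r C q m n : ℕ) (hn : n = (3 * m + 1) * (r * (3 * m + C + 1) + q)) :
    (m * (3 * n + 1) + 1) * (r * (m * (3 * n + 1) + C * n + 1) + (n + 1) * q) <
      (n + 1) * ((n + 1) * (n + 1)) := by
  have h1 : m * (3 * n + 1) + 1 ≤ (3 * m + 1) * (n + 1) := by nlinarith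
  have h2 : m * (3 * n + 1) + C * n + 1 ≤ (3 * m + C + 1) * (n + 1) := by nlinarith
  calc _ ≤ ((3 * m + 1) * (n + 1)) * (r * ((3 * m + C + 1) * (n + 1)) + (n + 1) * q) := by gcongr
    _ = ((3 * m + 1) * (r * (3 * m + C + 1) + q)) * ((n + 1) * (n + 1)) := by ring
    _ = n * ((n + 1) * (n + 1)) := by rw [← hn]
    _ < _ := by gcongr; omega

/-- Creative telescoping. If `M` kills the image of a nonzero differential operator in `x` with
polynomial coefficients, and `F` is rational, then `M F` is killed by a nonzero differential operator
in `t`. -/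
theorem exists_telescoper [CharZero 𝕜] {dx dt : Derivation 𝕜 R R} {X T : R}
    (hxX : dx X = 1) (hxT : dx T = 0) (htX : dt X = 0) (htT : dt T = 1)
    {M : R →ₗ[𝕜] V} {τ δ : Module.End 𝕜 V} (hτ : ∀ z, M (T * z) = τ (M z))
    (hδ : ∀ z, M (dt z) = δ (M z)) {r : ℕ} {c : ℕ → Polynomial 𝕜} (hc : c r ≠ 0)
    (hM : ∀ z, M (∑ i ∈ Finset.range (r + 1),
      ((dx : R →ₗ[𝕜] R) ^ i) (Polynomial.aeval X (c i) * z)) = 0)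
    {β B F : R} {m : ℕ} (hB : B ∈ polySpan 𝕜 X T m) (hTB : T * B ∈ polySpan 𝕜 X T m)
    (hBF : B * F ∈ polySpan 𝕜 X T m) (hβ : β * B = 1) :
    ∃ (y : ℕ) (e : ℕ → ℕ → 𝕜), (∃ i < y, ∃ j < y, e i j ≠ 0) ∧
      ∑ i ∈ Finset.range y, ∑ j ∈ Finset.range y, e i j • (τ ^ i) ((δ ^ j) (M F)) = 0 := by
  set C := (Finset.range (r + 1)).sup fun i => (c i).natDegree
  have hC : ∀ i ≤ r, (c i).natDegree ≤ C := fun i hi =>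
    Finset.le_sup (f := fun i => (c i).natDegree) (Finset.mem_range.2 (Nat.lt_succ_iff.2 hi))
  obtain ⟨n, hn⟩ : ∃ n, n = (3 * m + 1) * (r * (3 * m + C + 1) + (c r).natDegree) := ⟨_, rfl⟩
  -- One unit for `F` itself, and at most `n` each for the powers of `T`, `dt` and `dx`.
  set K := 3 * n + 1
  set N := m * K + C * n
  have hF : F ∈ ratSpan 𝕜 X T β m 1 := mem_ratSpan.2 ⟨B * F, by simpa using hBF, by
    linear_combination F * hβ⟩
  obtain ⟨s, hs, hsub⟩ := finite_basicFunctionals dx X M τ (LinearMap.mulLeft 𝕜 (β ^ K)) r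
    (c r).natDegree n N (m * K)
  let E : Fin (n + 1) × Fin (n + 1) × Fin (n + 1) → (R →ₗ[𝕜] V) := fun x =>
    M ∘ₗ (LinearMap.mulLeft 𝕜 (T ^ (x.1 : ℕ) * ((dt : R →ₗ[𝕜] R) ^ (x.2.1 : ℕ)) F) *
      (dx : R →ₗ[𝕜] R) ^ (x.2.2 : ℕ))
  have hE : ∀ x, E x ∈ Submodule.span 𝕜 (s : Set (R →ₗ[𝕜] V)) := by
    rintro ⟨i, j, k⟩
    refine Submodule.span_mono hsub (mulLeft_comp_mem hxX hxT hτ hc hC hM hB hβ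
      (Nat.lt_succ_iff.1 k.2) le_rfl (j := 1 + (j : ℕ) + (i : ℕ)) ?_ ?_)
    · omega
    · exact T_pow_mul_mem_ratSpan hTB hβ (derivation_pow_mem_ratSpan hB hβ dt
        (by rw [htX]; exact zero_mem _) (by rw [htT]; exact one_mem_polySpan X T 0) hF _) _
  have hnot := not_linearIndependent_of_mem_span E s (by
    simp only [Fintype.card_prod, Fintype.card_fin]
    exact hs.trans_lt (card_bound r C _ m n hn)) hE
  obtain ⟨g, hg, ⟨i₁, j₁, k₁⟩, hne⟩ := Fintype.not_linearIndependent_iff.1 hnot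
  -- Extension of the coefficients by zero outside the box; a nonzero coefficient therefore forces
  -- its indices into range.
  let e : ℕ → ℕ → ℕ → 𝕜 := fun i j k =>
    if h : i < n + 1 ∧ j < n + 1 ∧ k < n + 1 then g (⟨i, h.1⟩, ⟨j, h.2.1⟩, ⟨k, h.2.2⟩) else 0
  have hge : ∀ x : Fin (n + 1) × Fin (n + 1) × Fin (n + 1), g x = e x.1 x.2.1 x.2.2 := by
    rintro ⟨i, j, k⟩
    have hijk : (i : ℕ) < n + 1 ∧ (j : ℕ) < n + 1 ∧ (k : ℕ) < n + 1 := ⟨i.2, j.2, k.2⟩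
    simp only [e, dif_pos hijk]
  have hex : ∃ k, ∃ i < n + 1, ∃ j < n + 1, e i j k ≠ 0 :=
    ⟨k₁, i₁, i₁.2, j₁, j₁.2, by rw [← hge (i₁, j₁, k₁)]; exact hne⟩
  classical
  -- Take the lowest order in `dx` that occurs and test the relation on `X ^ k₀`: lower orders are
  -- absent, higher ones kill `X ^ k₀`, and order `k₀` produces `k₀!`, nonzero in characteristic
  -- zero.
  let k₀ := Nat.find hex
  obtain ⟨i₀, hi₀, j₀, hj₀, he₀⟩ := Nat.find_spec hex
  have hmin : ∀ k < k₀, ∀ i < n + 1, ∀ j < n + 1, e i j k = 0 := by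
    intro k hk i hi j hj
    by_contra h
    exact Nat.find_min hex hk ⟨i, hi, j, hj, h⟩
  have hk₀ : k₀ < n + 1 := by
    by_contra h
    exact he₀ (dif_neg fun h' => h h'.2.2)
  refine ⟨n + 1, fun i j => e i j k₀, ⟨i₀, hi₀, j₀, hj₀, he₀⟩, ?_⟩
  have hsum : ∑ i ∈ Finset.range (n + 1), ∑ j ∈ Finset.range (n + 1), ∑ k ∈ Finset.range (n + 1),
      e i j k • M (T ^ i * ((dt : R →ₗ[𝕜] R) ^ j) F * ((dx : R →ₗ[𝕜] R) ^ k) (X ^ k₀)) = 0 := by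
    have := LinearMap.congr_fun hg (X ^ k₀)
    simp only [Fintype.sum_prod_type, LinearMap.sum_apply, LinearMap.smul_apply, hge, E,
      LinearMap.comp_apply, Module.End.mul_apply, LinearMap.mulLeft_apply,
      LinearMap.zero_apply] at this
    simpa only [Finset.sum_range] using this
  have hfac : (k₀.factorial : 𝕜) ≠ 0 := by exact_mod_cast k₀.factorial_ne_zero
  have hterm : ∀ i ∈ Finset.range (n + 1), ∀ j ∈ Finset.range (n + 1),
      ∑ k ∈ Finset.range (n + 1),
        e i j k • M (T ^ i * ((dt : R →ₗ[𝕜] R) ^ j) F * ((dx : R →ₗ[𝕜] R) ^ k) (X ^ k₀)) =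
      (k₀.factorial : 𝕜) • (e i j k₀ • (τ ^ i) ((δ ^ j) (M F))) := by
    intro i hi j hj
    rw [Finset.sum_eq_single_of_mem k₀ (Finset.mem_range.2 hk₀)]
    · have h1 : T ^ i * ((dt : R →ₗ[𝕜] R) ^ j) F * (k₀.factorial : R) =
          (k₀.factorial : 𝕜) • (T ^ i * ((dt : R →ₗ[𝕜] R) ^ j) F) := by
        rw [Algebra.smul_def, map_natCast, mul_comm]
      rw [derivation_pow_apply_pow hxX, h1, map_smul, mulLeft_pow_apply_comm hτ,
        pow_apply_comm M (dt : R →ₗ[𝕜] R) δ hδ, smul_comm]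
    · intro k _ hk
      rcases lt_or_gt_of_ne hk with h | h
      · rw [hmin k h i (Finset.mem_range.1 hi) j (Finset.mem_range.1 hj), zero_smul]
      · rw [derivation_pow_apply_pow_of_lt hxX h, mul_zero, map_zero, smul_zero]
  rw [Finset.sum_congr rfl fun i hi => Finset.sum_congr rfl (hterm i hi)] at hsum
  simp only [← Finset.smul_sum] at hsum
  exact (smul_eq_zero.1 hsum).resolve_left hfac

end Telescoping

/-! ### Rational generating functions, and from differential operators to recurrences. -/

section GeneratingFunction

variable {𝕜 : Type*} [Field 𝕜]

theorem coeff_base_smul {A : Type*} [CommRing A] [Algebra 𝕜 A] (c : 𝕜) (f : PowerSeries A)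
    (n : ℕ) : PowerSeries.coeff n (c • f) = c • PowerSeries.coeff n f :=
  rfl

theorem C_algebraMap_mul_mul {A : Type*} [CommRing A] [Algebra 𝕜 A] (c : 𝕜) (x : A)
    (f : PowerSeries A) :
    PowerSeries.C (algebraMap 𝕜 A c * x) * f = c • (PowerSeries.C x * f) := by
  ext n
  rw [coeff_base_smul, PowerSeries.coeff_C_mul, PowerSeries.coeff_C_mul, Algebra.smul_def,
    mul_assoc]

theorem aeval_powerSeries_C {A : Type*} [CommRing A] [Algebra 𝕜 A] (x : A) (p : Polynomial 𝕜) :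
    Polynomial.aeval (PowerSeries.C x) p = PowerSeries.C (Polynomial.aeval x p) :=
  Polynomial.aeval_algebraMap_apply (PowerSeries A) x p

/-- The derivative of power series, as a derivation over a base field of the coefficient ring. -/
noncomputable def baseDerivative (𝕜 A : Type*) [Field 𝕜] [CommRing A] [Algebra 𝕜 A] :
    Derivation 𝕜 (PowerSeries A) (PowerSeries A) :=
  (PowerSeries.derivative A).restrictScalars 𝕜

/-- The derivation on `𝕜[x]⟦t⟧` differentiating every coefficient with respect to `x`. -/
noncomputable def coeffDerivation (𝕜 : Type*) [Field 𝕜] :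
    Derivation 𝕜 (PowerSeries (Polynomial 𝕜)) (PowerSeries (Polynomial 𝕜)) :=
  Derivation.mk'
    { toFun := fun f => PowerSeries.mk fun n => Polynomial.derivative (PowerSeries.coeff n f)
      map_add' := fun f g => by ext1 n; simp
      map_smul' := fun c f => by
        ext1 n
        simp only [PowerSeries.coeff_mk, RingHom.id_apply]
        rw [coeff_base_smul, coeff_base_smul, PowerSeries.coeff_mk, Polynomial.derivative_smul] }
    fun f g => by
      ext1 n
      simp only [LinearMap.coe_mk, AddHom.coe_mk, PowerSeries.coeff_mk, smul_eq_mul, map_add,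
        PowerSeries.coeff_mul, Polynomial.derivative_sum, Polynomial.derivative_mul,
        Finset.sum_add_distrib]
      rw [add_comm, ← Finset.Nat.sum_antidiagonal_swap (n := n)
        (f := fun x => PowerSeries.coeff x.1 g * _)]
      congr 1
      exact Finset.sum_congr rfl fun x _ => mul_comm _ _

theorem coeff_coeffDerivation (f : PowerSeries (Polynomial 𝕜)) (n : ℕ) :
    PowerSeries.coeff n (coeffDerivation 𝕜 f) = Polynomial.derivative (PowerSeries.coeff n f) := by
  change PowerSeries.coeff n
    (PowerSeries.mk fun n => Polynomial.derivative (PowerSeries.coeff n f)) = _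
  rw [PowerSeries.coeff_mk]

/-- The coefficientwise extension of a linear functional on `𝕜[x]` to `𝕜[x]⟦t⟧`. -/
noncomputable def coeffFunctional (M : Polynomial 𝕜 →ₗ[𝕜] 𝕜) :
    PowerSeries (Polynomial 𝕜) →ₗ[𝕜] PowerSeries 𝕜 where
  toFun f := PowerSeries.mk fun n => M (PowerSeries.coeff n f)
  map_add' f g := by ext n; simp
  map_smul' c f := by
    ext n
    simp only [PowerSeries.coeff_mk, coeff_base_smul, map_smul, RingHom.id_apply]

theorem coeff_coeffFunctional (M : Polynomial 𝕜 →ₗ[𝕜] 𝕜) (f : PowerSeries (Polynomial 𝕜)) (n : ℕ) :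
    PowerSeries.coeff n (coeffFunctional M f) = M (PowerSeries.coeff n f) := by
  change PowerSeries.coeff n (PowerSeries.mk fun n => M (PowerSeries.coeff n f)) = _
  rw [PowerSeries.coeff_mk]

theorem coeffFunctional_X_mul (M : Polynomial 𝕜 →ₗ[𝕜] 𝕜) (f : PowerSeries (Polynomial 𝕜)) :
    coeffFunctional M (PowerSeries.X * f) =
      LinearMap.mulLeft 𝕜 PowerSeries.X (coeffFunctional M f) := by
  ext n
  rw [LinearMap.mulLeft_apply, coeff_coeffFunctional]
  rcases n with _ | n
  · simp
  · rw [PowerSeries.coeff_succ_X_mul, PowerSeries.coeff_succ_X_mul, coeff_coeffFunctional]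

theorem coeffFunctional_derivative (M : Polynomial 𝕜 →ₗ[𝕜] 𝕜)
    (f : PowerSeries (Polynomial 𝕜)) :
    coeffFunctional M (PowerSeries.derivative (Polynomial 𝕜) f) =
      (PowerSeries.derivative 𝕜 : PowerSeries 𝕜 →ₗ[𝕜] PowerSeries 𝕜) (coeffFunctional M f) := by
  ext n
  rw [coeff_coeffFunctional, Derivation.coeFn_coe, PowerSeries.coeff_derivative,
    PowerSeries.coeff_derivative, coeff_coeffFunctional]
  rw [← Nat.cast_succ, mul_comm, ← nsmul_eq_mul, map_nsmul, nsmul_eq_mul, mul_comm, Nat.cast_succ]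

theorem coe_mem_polySpan (p : Polynomial (Polynomial 𝕜)) : ∃ m, ∀ m' ≥ m,
    (p : PowerSeries (Polynomial 𝕜)) ∈
      polySpan 𝕜 (PowerSeries.C (Polynomial.X : Polynomial 𝕜)) PowerSeries.X m' := by
  induction p using Polynomial.induction_on' with
  | add p q hp hq =>
    obtain ⟨m, hm⟩ := hp
    obtain ⟨n, hn⟩ := hq
    refine ⟨max m n, fun k hk => ?_⟩
    rw [Polynomial.coe_add]
    exact add_mem (hm k (le_of_max_le_left hk)) (hn k (le_of_max_le_right hk))
  | monomial b q =>
    refine ⟨max b q.natDegree, fun k hk => ?_⟩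
    have h : ((Polynomial.monomial b q : Polynomial (Polynomial 𝕜)) :
        PowerSeries (Polynomial 𝕜)) = ∑ a ∈ Finset.range (q.natDegree + 1), q.coeff a •
          ((PowerSeries.C (Polynomial.X : Polynomial 𝕜)) ^ a * PowerSeries.X ^ b) := by
      rw [Polynomial.coe_monomial, PowerSeries.monomial_eq_C_mul_X_pow]
      conv_lhs => rw [q.as_sum_range_C_mul_X_pow]
      rw [map_sum, Finset.sum_mul]
      refine Finset.sum_congr rfl fun a _ => ?_
      rw [← map_pow, ← C_algebraMap_mul_mul]
      rfl
    rw [h]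
    refine Submodule.sum_mem _ fun a ha => Submodule.smul_mem _ _ (monomial_mem_polySpan _ _ ?_ ?_)
    · have := Finset.mem_range.1 ha
      have := le_of_max_le_right hk
      omega
    · exact le_of_max_le_left hk

theorem coeffDerivation_pow_coeff (f : PowerSeries (Polynomial 𝕜)) (i n : ℕ) :
    PowerSeries.coeff n (((coeffDerivation 𝕜 :
      PowerSeries (Polynomial 𝕜) →ₗ[𝕜] PowerSeries (Polynomial 𝕜)) ^ i) f) =
      Polynomial.derivative^[i] (PowerSeries.coeff n f) := by
  induction i with
  | zero => simp
  | succ i ih =>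
    rw [pow_succ', Module.End.mul_apply, Derivation.coeFn_coe, coeff_coeffDerivation, ih,
      Function.iterate_succ_apply']

theorem aeval_C_X (p : Polynomial 𝕜) :
    Polynomial.aeval (PowerSeries.C (Polynomial.X : Polynomial 𝕜)) p =
      (PowerSeries.C p : PowerSeries (Polynomial 𝕜)) := by
  rw [aeval_powerSeries_C, Polynomial.aeval_X_left_apply]

/-- The generating function of a C-finite sequence of polynomials is rational. -/
theorem IsCFinite.exists_polynomial {P : ℕ → Polynomial 𝕜} (hP : IsCFinite P) :
    ∃ B N : Polynomial (Polynomial 𝕜), B.coeff 0 = 1 ∧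
      (B : PowerSeries (Polynomial 𝕜)) * PowerSeries.mk P = N := by
  obtain ⟨L, p, hL, hp⟩ := hP
  set B : Polynomial (Polynomial 𝕜) :=
    1 - ∑ i ∈ Finset.Icc 1 L, Polynomial.C (p i) * Polynomial.X ^ i
  -- The numerator is the product cut off at degree `L`; the recurrence says that all later
  -- coefficients vanish.
  refine ⟨B, (B * PowerSeries.mk P : PowerSeries (Polynomial 𝕜)).trunc L, ?_, ?_⟩
  · simp only [B, Polynomial.coeff_sub, Polynomial.coeff_one_zero, Polynomial.finsetSum_coeff]
    rw [Finset.sum_eq_zero, sub_zero]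
    intro i hi
    have : i ≠ 0 := by have := (Finset.mem_Icc.1 hi).1; omega
    simp [Polynomial.coeff_X_pow, this.symm]
  · ext1 n
    rw [Polynomial.coeff_coe, PowerSeries.coeff_trunc]
    split_ifs with h
    · rfl
    · push Not at h
      have hB : (B : PowerSeries (Polynomial 𝕜)) =
          1 - ∑ i ∈ Finset.Icc 1 L, PowerSeries.C (p i) * PowerSeries.X ^ i := by
        have := map_sum (Polynomial.coeToPowerSeries.ringHom (R := Polynomial 𝕜))
          (fun i => Polynomial.C (p i) * Polynomial.X ^ i) (Finset.Icc 1 L)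
        simp only [Polynomial.coeToPowerSeries.ringHom_apply, Polynomial.coe_mul,
          Polynomial.coe_pow, Polynomial.coe_C, Polynomial.coe_X] at this
        rw [Polynomial.coe_sub, Polynomial.coe_one, this]
      rw [hB, sub_mul, one_mul, map_sub, PowerSeries.coeff_mk, Finset.sum_mul, map_sum, hp n h,
        sub_eq_zero]
      refine Finset.sum_congr rfl fun i hi => ?_
      have hi' : i ≤ n := (Finset.mem_Icc.1 hi).2.trans h
      rw [mul_assoc, PowerSeries.coeff_C_mul]
      conv_rhs => rw [← Nat.sub_add_cancel hi']
      rw [PowerSeries.coeff_X_pow_mul, PowerSeries.coeff_mk]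

/-- Applying to a C-finite sequence of polynomials a linear functional that kills the image of a
nonzero differential operator with polynomial coefficients gives a sequence whose generating function
is killed by a nonzero differential operator with polynomial coefficients. -/
theorem IsCFinite.exists_diffOp [CharZero 𝕜] {P : ℕ → Polynomial 𝕜} (hP : IsCFinite P)
    (M : Polynomial 𝕜 →ₗ[𝕜] 𝕜) {r : ℕ} {c : ℕ → Polynomial 𝕜} (hc : c r ≠ 0)
    (hM : ∀ q, M (∑ i ∈ Finset.range (r + 1), Polynomial.derivative^[i] (c i * q)) = 0) :
    ∃ (y : ℕ) (e : ℕ → ℕ → 𝕜), (∃ i < y, ∃ j < y, e i j ≠ 0) ∧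
      ∑ i ∈ Finset.range y, ∑ j ∈ Finset.range y, e i j •
        (PowerSeries.X ^ i * (PowerSeries.derivative 𝕜)^[j]
          (PowerSeries.mk fun n => M (P n))) = 0 := by
  obtain ⟨B, N, hB0, hBN⟩ := hP.exists_polynomial
  obtain ⟨m₁, h₁⟩ := coe_mem_polySpan B
  obtain ⟨m₂, h₂⟩ := coe_mem_polySpan (Polynomial.X * B)
  obtain ⟨m₃, h₃⟩ := coe_mem_polySpan N
  rw [Polynomial.coe_mul, Polynomial.coe_X] at h₂
  -- Since `B` has constant term 1 in `t`, its inverse exists already in `𝕜[x]⟦t⟧`, where `M` can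
  -- act coefficientwise.
  obtain ⟨β, hβ⟩ : ∃ β : PowerSeries (Polynomial 𝕜), β * B = 1 := by
    have : IsUnit (B : PowerSeries (Polynomial 𝕜)) := by
      rw [PowerSeries.isUnit_iff_constantCoeff, ← PowerSeries.coeff_zero_eq_constantCoeff_apply,
        Polynomial.coeff_coe, hB0]
      exact isUnit_one
    exact this.exists_left_inv
  obtain ⟨y, e, he, h⟩ := exists_telescoper (𝕜 := 𝕜) (dx := coeffDerivation 𝕜)
    (dt := baseDerivative 𝕜 (Polynomial 𝕜))
    (X := PowerSeries.C (Polynomial.X : Polynomial 𝕜)) (T := PowerSeries.X)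
    (by
      ext1 n
      rw [coeff_coeffDerivation, PowerSeries.coeff_C, PowerSeries.coeff_one]
      split_ifs <;> simp)
    (by
      ext1 n
      rw [coeff_coeffDerivation, PowerSeries.coeff_X]
      split_ifs <;> simp)
    (PowerSeries.derivative_C ..)
    (PowerSeries.derivative_X ..)
    (M := coeffFunctional M) (coeffFunctional_X_mul M) (coeffFunctional_derivative M) hc
    (by
      intro z
      ext n
      rw [coeff_coeffFunctional, map_sum]
      simp only [coeffDerivation_pow_coeff, aeval_C_X, PowerSeries.coeff_C_mul]
      exact hM _)
    (m := max m₁ (max m₂ m₃)) (F := PowerSeries.mk P)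
    (h₁ _ (le_max_left _ _)) (h₂ _ ((le_max_left _ _).trans (le_max_right _ _)))
    (by rw [hBN]; exact h₃ _ ((le_max_right _ _).trans (le_max_right _ _))) hβ
  refine ⟨y, e, he, ?_⟩
  rw [← h]
  refine Finset.sum_congr rfl fun i _ => Finset.sum_congr rfl fun j _ => ?_
  rw [LinearMap.pow_mulLeft, LinearMap.mulLeft_apply, Module.End.pow_apply]
  congr 3
  ext n
  simp [coeff_coeffFunctional]

theorem coeff_iterate_derivative (f : PowerSeries 𝕜) (j n : ℕ) :
    PowerSeries.coeff n ((PowerSeries.derivative 𝕜)^[j] f) =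
      ((n + j).descFactorial j : 𝕜) * PowerSeries.coeff (n + j) f := by
  induction j generalizing n with
  | zero => simp
  | succ j ih =>
    rw [Function.iterate_succ_apply', PowerSeries.coeff_derivative, ih,
      show n + 1 + j = n + (j + 1) by ring, Nat.descFactorial_succ,
      show n + (j + 1) - j = n + 1 by omega]
    push_cast
    ring

/-- Collect terms by order of derivative and stop at the last nonzero coefficient. Its order is
positive unless `f = 0`, because `𝕜⟦t⟧` is a domain; for `f = 0` any equation of order one serves.
-/
theorem satisfiesInhomogeneousODE_of_diffOp {f : PowerSeries 𝕜} {y : ℕ} {e : ℕ → ℕ → 𝕜}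
    (he : ∃ i < y, ∃ j < y, e i j ≠ 0)
    (h : ∑ i ∈ Finset.range y, ∑ j ∈ Finset.range y, e i j •
        (PowerSeries.X ^ i * (PowerSeries.derivative 𝕜)^[j] f) = 0) :
    SatisfiesInhomogeneousODE f := by
  classical
  by_cases hf : f = 0
  · refine ⟨1, fun _ => 1, 0, one_pos, one_ne_zero, ?_⟩
    simp [hf]
  let b : ℕ → Polynomial 𝕜 := fun j => ∑ i ∈ Finset.range y, Polynomial.monomial i (e i j)
  have hsum : ∑ j ∈ Finset.range y, (b j : PowerSeries 𝕜) * (PowerSeries.derivative 𝕜)^[j] f = 0 := by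
    rw [← h, Finset.sum_comm]
    refine Finset.sum_congr rfl fun j _ => ?_
    have hb : (b j : PowerSeries 𝕜) = ∑ i ∈ Finset.range y, e i j • PowerSeries.X ^ i := by
      have := map_sum (Polynomial.coeToPowerSeries.ringHom (R := 𝕜))
        (fun i => Polynomial.monomial i (e i j)) (Finset.range y)
      simp only [Polynomial.coeToPowerSeries.ringHom_apply, Polynomial.coe_monomial,
        PowerSeries.monomial_eq_C_mul_X_pow] at this
      simp only [b, this, PowerSeries.smul_eq_C_mul]
    rw [hb, Finset.sum_mul]
    simp only [smul_mul_assoc]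
  have hne : ((Finset.range y).filter fun j => b j ≠ 0).Nonempty := by
    obtain ⟨i, hi, j, hj, hij⟩ := he
    refine ⟨j, Finset.mem_filter.2 ⟨Finset.mem_range.2 hj, fun h0 => hij ?_⟩⟩
    have := congrArg (fun p => Polynomial.coeff p i) h0
    simpa [b, Polynomial.finsetSum_coeff, Polynomial.coeff_monomial, hi] using this
  obtain ⟨d, hd, hmax⟩ := Finset.exists_max_image _ id hne
  rw [Finset.mem_filter, Finset.mem_range] at hd
  have hsum' : ∑ j ∈ Finset.range (d + 1),
      (b j : PowerSeries 𝕜) * (PowerSeries.derivative 𝕜)^[j] f = 0 := by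
    rw [← hsum]
    refine Finset.sum_subset (Finset.range_mono (by omega)) fun j hj hj' => ?_
    have : b j = 0 := by
      by_contra hb
      have := hmax j (Finset.mem_filter.2 ⟨hj, hb⟩)
      simp only [id, Finset.mem_range] at this hj'
      omega
    simp [this]
  refine ⟨d, b, 0, ?_, hd.2, by rw [hsum']; simp⟩
  rw [Nat.pos_iff_ne_zero]
  rintro rfl
  rw [Finset.sum_range_one, Function.iterate_zero, id, mul_eq_zero] at hsum'
  rcases hsum' with h0 | h0
  · exact hd.2 (by exact_mod_cast h0)
  · exact hf h0

/-- The coefficient of `t^(n+y)` in `t^i f^(j)` is a falling factorial of length `j` times `a (n + y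
- i + j)`. Reading at `n + y` rather than `n` makes all shifts `y - i + j` positive, so the order is
at least one. -/
theorem isPRecursive_of_diffOp {a : ℕ → 𝕜} {y : ℕ} {e : ℕ → ℕ → 𝕜}
    (he : ∃ i < y, ∃ j < y, e i j ≠ 0)
    (h : ∑ i ∈ Finset.range y, ∑ j ∈ Finset.range y, e i j •
        (PowerSeries.X ^ i * (PowerSeries.derivative 𝕜)^[j] (PowerSeries.mk a)) = 0) :
    IsPRecursive a := by
  classical
  let w : ℕ → ℕ → Polynomial 𝕜 := fun k j =>
    (descPochhammer 𝕜 j).comp (Polynomial.X + Polynomial.C (k : 𝕜))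
  have hmonic : ∀ k j, (w k j).Monic := fun k j =>
    (monic_descPochhammer 𝕜 j).comp (Polynomial.monic_X_add_C _)
      (by rw [Polynomial.natDegree_X_add_C]; exact one_ne_zero)
  have hdeg : ∀ k j, (w k j).natDegree = j := fun k j => by
    simp only [w, Polynomial.natDegree_comp, Polynomial.natDegree_X_add_C,
      descPochhammer_natDegree, mul_one]
  have hw : ∀ k j n : ℕ, (w k j).eval (n : 𝕜) = ((n + k).descFactorial j : 𝕜) := by
    intro k j n
    simp only [w, Polynomial.eval_comp, Polynomial.eval_add, Polynomial.eval_X, Polynomial.eval_C]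
    rw [← Nat.cast_add, descPochhammer_eval_eq_descFactorial]
  let s : ℕ → Polynomial 𝕜 := fun k => ∑ i ∈ Finset.range y, ∑ j ∈ Finset.range y,
    if y - i + j = k then e i j • w k j else 0
  have hrec : ∀ n : ℕ, ∑ k ∈ Finset.range (2 * y), (s k).eval (n : 𝕜) * a (n + k) = 0 := by
    intro n
    have h1 := congrArg (PowerSeries.coeff (n + y)) h
    rw [map_zero, map_sum] at h1
    rw [← h1]
    simp only [s, Polynomial.eval_finsetSum, Finset.sum_mul]
    rw [Finset.sum_comm]
    refine Finset.sum_congr rfl fun i hi => ?_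
    rw [Finset.sum_comm, map_sum]
    refine Finset.sum_congr rfl fun j hj => ?_
    rw [Finset.mem_range] at hi hj
    rw [Finset.sum_eq_single_of_mem (y - i + j) (Finset.mem_range.2 (by omega))]
    · rw [if_pos rfl, Polynomial.eval_smul, hw, PowerSeries.coeff_smul,
        show n + y = n + (y - i) + i by omega, PowerSeries.coeff_X_pow_mul,
        coeff_iterate_derivative, PowerSeries.coeff_mk, add_assoc, smul_eq_mul, smul_eq_mul,
        mul_assoc]
    · intro k _ hk
      rw [if_neg hk.symm, Polynomial.eval_zero, zero_mul]
  -- With `j₀` the largest order present, only the pair `(i₀, j₀)` contributes degree `j₀` to its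
  -- shift: other pairs with that shift and a nonzero coefficient have smaller `j`, hence smaller
  -- degree. So no cancellation can occur.
  obtain ⟨i₀, j₀, hi₀, hj₀, he₀, hmax₀⟩ : ∃ i₀ j₀, i₀ < y ∧ j₀ < y ∧ e i₀ j₀ ≠ 0 ∧
      ∀ i < y, ∀ j < y, e i j ≠ 0 → j ≤ j₀ := by
    obtain ⟨i, hi, j, hj, hij⟩ := he
    obtain ⟨x, hx, hmax⟩ := Finset.exists_max_image
      ((Finset.range y ×ˢ Finset.range y).filter fun x => e x.1 x.2 ≠ 0) Prod.snd
      ⟨(i, j), by simp [hi, hj, hij]⟩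
    simp only [Finset.mem_filter, Finset.mem_product, Finset.mem_range] at hx hmax
    exact ⟨x.1, x.2, hx.1.1, hx.1.2, hx.2, fun i hi j hj hij => hmax (i, j) ⟨⟨hi, hj⟩, hij⟩⟩
  have hs₀ : s (y - i₀ + j₀) ≠ 0 := by
    intro h0
    have h1 := congrArg (fun p => Polynomial.coeff p j₀) h0
    simp only [s, Polynomial.finsetSum_coeff, Polynomial.coeff_zero] at h1
    rw [Finset.sum_eq_single_of_mem i₀ (Finset.mem_range.2 hi₀),
      Finset.sum_eq_single_of_mem j₀ (Finset.mem_range.2 hj₀), if_pos rfl, Polynomial.coeff_smul]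
      at h1
    · have := (hmonic (y - i₀ + j₀) j₀).coeff_natDegree
      rw [hdeg] at this
      rw [this, smul_eq_mul, mul_one] at h1
      exact he₀ h1
    · intro j _ hj
      rw [if_neg (by omega), Polynomial.coeff_zero]
    · intro i hi hne
      refine Finset.sum_eq_zero fun j hj => ?_
      rw [Finset.mem_range] at hi hj
      split_ifs with hk
      · by_cases hij : e i j = 0
        · simp [hij]
        · have := hmax₀ i hi j hj hij
          rw [Polynomial.coeff_smul, Polynomial.coeff_eq_zero_of_natDegree_lt, smul_zero]
          rw [hdeg]
          omega
      · rfl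
  obtain ⟨d, hd, hmax⟩ := Finset.exists_max_image
    ((Finset.range (2 * y)).filter fun k => s k ≠ 0) id
    ⟨y - i₀ + j₀, by
      rw [Finset.mem_filter, Finset.mem_range]
      exact ⟨by omega, hs₀⟩⟩
  have hd₀ := hmax (y - i₀ + j₀) (by
    rw [Finset.mem_filter, Finset.mem_range]
    exact ⟨by omega, hs₀⟩)
  rw [Finset.mem_filter, Finset.mem_range] at hd
  simp only [id] at hd₀
  refine ⟨d, s, by omega, hd.2, fun n => ?_⟩
  rw [← hrec n]
  refine Finset.sum_subset (Finset.range_mono (by omega)) fun k hk hk' => ?_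
  have : s k = 0 := by
    by_contra hb
    have := hmax k (Finset.mem_filter.2 ⟨hk, hb⟩)
    simp only [id, Finset.mem_range] at this hk'
    omega
  simp [this]

end GeneratingFunction

open scoped ContDiff Topology

/-! ### Cutoffs in a polynomial `s`, with bounds uniform in the cutoff parameter. -/

section Analysis

variable {𝕜 : Type*} [RCLike 𝕜]

theorem Polynomial.hasDerivAt_eval_ofReal (p : Polynomial 𝕜) (x : ℝ) :
    HasDerivAt (fun x : ℝ => p.eval (x : 𝕜)) (p.derivative.eval (x : 𝕜)) x := by
  have h : HasDerivAt (fun x : ℝ => (x : 𝕜)) 1 x := by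
    simpa using (RCLike.ofRealCLM (K := 𝕜)).hasDerivAt (x := x)
  simpa [Function.comp_def] using HasDerivAt.scomp x (p.hasDerivAt (x : 𝕜)) h

theorem Polynomial.contDiff_eval {F : Type*} [NontriviallyNormedField F] (p : Polynomial F) :
    ContDiff F ∞ (fun z : F => p.eval z) := by
  simpa [Polynomial.coe_aeval_eq_eval] using p.contDiff_aeval (𝕜 := F) ∞

theorem Polynomial.contDiff_eval_ofReal (p : Polynomial 𝕜) :
    ContDiff ℝ ∞ (fun x : ℝ => p.eval (x : 𝕜)) := by
  have h : ContDiff 𝕜 ∞ (fun z : 𝕜 => p.eval z) := contDiff_eval p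
  exact (h.restrict_scalars ℝ).comp (RCLike.ofRealCLM (K := 𝕜)).contDiff

theorem Polynomial.iteratedDeriv_eval_ofReal (p : Polynomial 𝕜) (i : ℕ) :
    iteratedDeriv i (fun x : ℝ => p.eval (x : 𝕜)) =
      fun x : ℝ => (Polynomial.derivative^[i] p).eval (x : 𝕜) := by
  induction i generalizing p with
  | zero => simp
  | succ i ih =>
    have : deriv (fun x : ℝ => p.eval (x : 𝕜)) = fun x : ℝ => p.derivative.eval (x : 𝕜) :=
      _root_.funext fun x => (p.hasDerivAt_eval_ofReal x).deriv
    rw [iteratedDeriv_succ', this, ih, Function.iterate_succ_apply]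

theorem eval_map_ofReal (s : Polynomial ℝ) (x : ℝ) :
    (s.map (algebraMap ℝ 𝕜)).eval (x : 𝕜) = ((s.eval x : ℝ) : 𝕜) := by
  have := Polynomial.eval_map_apply (f := algebraMap ℝ 𝕜) (p := s) x
  simpa using this

/-- A smooth function on the line that is constant outside a compact set. -/
def IsCutoff (A : ℝ → ℝ) : Prop :=
  ContDiff ℝ ∞ A ∧ ∃ c, HasCompactSupport fun u => A u - c

theorem IsCutoff.id_mul_deriv {A : ℝ → ℝ} (hA : IsCutoff A) :
    IsCutoff fun u => u * deriv A u := by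
  obtain ⟨h, c, hc⟩ := hA
  refine ⟨contDiff_id.mul (contDiff_infty_iff_deriv.1 h).2, 0, ?_⟩
  have h1 : deriv (fun u => A u - c) = deriv A := by
    ext u
    rw [deriv_sub_const]
  have h2 : HasCompactSupport (deriv A) := h1 ▸ hc.deriv
  simpa [Pi.mul_def] using h2.mul_left (f := fun u => u)

theorem IsCutoff.bounded {A : ℝ → ℝ} (hA : IsCutoff A) : ∃ C, ∀ u, |A u| ≤ C := by
  obtain ⟨h, c, hc⟩ := hA
  obtain ⟨C, hC⟩ := hc.exists_bound_of_continuous (h.continuous.sub continuous_const)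
  refine ⟨C + |c|, fun u => ?_⟩
  have h1 : |A u - c| ≤ C := hC u
  have h2 := abs_add_le (A u - c) c
  rw [sub_add_cancel] at h2
  linarith

/-- The function `A (n s) * B (s / n)`, where `s` is a polynomial and `n` is shifted by one. -/
noncomputable def cutoffFamily (s : Polynomial ℝ) (A B : ℝ → ℝ) (n : ℕ) (x : ℝ) : ℝ :=
  A ((n + 1) * s.eval x) * B ((n + 1 : ℝ)⁻¹ * s.eval x)

theorem contDiff_cutoffFamily (s : Polynomial ℝ) {A B : ℝ → ℝ} (hA : IsCutoff A) (hB : IsCutoff B)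
    (n : ℕ) : ContDiff ℝ ∞ (cutoffFamily s A B n) :=
  (hA.1.comp (contDiff_const.mul s.contDiff_eval)).mul (hB.1.comp (contDiff_const.mul s.contDiff_eval))

/-- The chain rule factor `n + 1` combines with the extra `s` into `u = (n + 1) * s`, and likewise
for the inverse scale. So `s * d/dx` acts as `s' * (u * d/du)` and no power of `n` survives. -/
theorem hasDerivAt_cutoffFamily (s : Polynomial ℝ) {A B : ℝ → ℝ} (hA : IsCutoff A)
    (hB : IsCutoff B) (n : ℕ) (x : ℝ) : ∃ D, HasDerivAt (cutoffFamily s A B n) D x ∧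
      s.eval x * D = s.derivative.eval x * (cutoffFamily s (fun u => u * deriv A u) B n x +
        cutoffFamily s A (fun u => u * deriv B u) n x) := by
  have hs := s.hasDerivAt x
  have h1 : ∀ {A : ℝ → ℝ} (_ : IsCutoff A) (c : ℝ), HasDerivAt (fun x => A (c * s.eval x))
      (deriv A (c * s.eval x) * (c * s.derivative.eval x)) x := fun {A} hA c =>
    ((hA.1.differentiable (by simp)).differentiableAt.hasDerivAt).comp x (hs.const_mul c)
  refine ⟨_, (h1 hA (n + 1)).mul (h1 hB (n + 1 : ℝ)⁻¹), ?_⟩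
  simp only [cutoffFamily]
  ring

/-- The families of functions spanned by the products of polynomials and cutoffs in `s`. -/
def cutoffSpan (𝕜 : Type*) [RCLike 𝕜] (s : Polynomial ℝ) : Submodule 𝕜 (ℕ → ℝ → 𝕜) :=
  Submodule.span 𝕜 {E | ∃ (p : Polynomial 𝕜) (A B : ℝ → ℝ), IsCutoff A ∧ IsCutoff B ∧
    E = fun n (x : ℝ) => p.eval (x : 𝕜) * (cutoffFamily s A B n x : 𝕜)}

theorem eval_mul_cutoffFamily_mem (s : Polynomial ℝ) (p : Polynomial 𝕜) {A B : ℝ → ℝ}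
    (hA : IsCutoff A) (hB : IsCutoff B) :
    (fun n (x : ℝ) => p.eval (x : 𝕜) * (cutoffFamily s A B n x : 𝕜)) ∈ cutoffSpan 𝕜 s :=
  Submodule.subset_span ⟨p, A, B, hA, hB, rfl⟩

theorem contDiff_of_mem_cutoffSpan {s : Polynomial ℝ} {E : ℕ → ℝ → 𝕜} (hE : E ∈ cutoffSpan 𝕜 s)
    (n : ℕ) : ContDiff ℝ ∞ (E n) := by
  induction hE using Submodule.span_induction with
  | zero => exact contDiff_const
  | add x y _ _ hx hy => exact hx.add hy
  | smul c x _ hx => exact (contDiff_const (c := c)).mul hx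
  | mem x hx =>
    obtain ⟨p, A, B, hA, hB, rfl⟩ := hx
    exact p.contDiff_eval_ofReal.mul
      ((RCLike.ofRealCLM (K := 𝕜)).contDiff.comp (contDiff_cutoffFamily s hA hB n))

theorem eval_mul_mem_cutoffSpan {s : Polynomial ℝ} {E : ℕ → ℝ → 𝕜} (hE : E ∈ cutoffSpan 𝕜 s)
    (q : Polynomial 𝕜) : (fun n (x : ℝ) => q.eval (x : 𝕜) * E n x) ∈ cutoffSpan 𝕜 s := by
  induction hE using Submodule.span_induction with
  | zero =>
    convert zero_mem (cutoffSpan 𝕜 s) using 1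
    ext n x
    simp
  | add x y _ _ hx hy =>
    convert add_mem hx hy using 1
    ext n x
    simp [mul_add]
  | smul c x _ hx =>
    convert Submodule.smul_mem _ c hx using 1
    ext n x
    simp [mul_left_comm]
  | mem x hx =>
    obtain ⟨p, A, B, hA, hB, rfl⟩ := hx
    convert eval_mul_cutoffFamily_mem s (q * p) hA hB using 3
    rw [Polynomial.eval_mul, mul_assoc]

theorem eval_mul_deriv_mem_cutoffSpan {s : Polynomial ℝ} {E : ℕ → ℝ → 𝕜}
    (hE : E ∈ cutoffSpan 𝕜 s) :
    (fun n x => ((s.eval x : ℝ) : 𝕜) * deriv (E n) x) ∈ cutoffSpan 𝕜 s := by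
  induction hE using Submodule.span_induction with
  | zero =>
    convert zero_mem (cutoffSpan 𝕜 s) using 1
    ext n x
    simp
  | add E F hE hF hE' hF' =>
    convert add_mem hE' hF' using 1
    ext n x
    have : deriv (E n + F n) x = deriv (E n) x + deriv (F n) x :=
      deriv_add ((contDiff_of_mem_cutoffSpan hE n).differentiable (by simp)).differentiableAt
        ((contDiff_of_mem_cutoffSpan hF n).differentiable (by simp)).differentiableAt
    simp [this, mul_add]
  | smul c E hE hE' =>
    convert Submodule.smul_mem _ c hE' using 1
    ext n x
    have : deriv (c • E n) x = c • deriv (E n) x :=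
      deriv_const_smul c
        ((contDiff_of_mem_cutoffSpan hE n).differentiable (by simp)).differentiableAt
    simp [this, mul_left_comm]
  | mem x hx =>
    obtain ⟨p, A, B, hA, hB, rfl⟩ := hx
    set s' : Polynomial 𝕜 := s.map (algebraMap ℝ 𝕜)
    have h1 := eval_mul_cutoffFamily_mem s (s' * p.derivative) hA hB
    have h2 := eval_mul_cutoffFamily_mem s (s'.derivative * p) hA.id_mul_deriv hB
    have h3 := eval_mul_cutoffFamily_mem s (s'.derivative * p) hA hB.id_mul_deriv
    convert add_mem h1 (add_mem h2 h3) using 1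
    ext n x
    obtain ⟨D, hD, hsD⟩ := hasDerivAt_cutoffFamily s hA hB n x
    have h4 : HasDerivAt (fun x => (cutoffFamily s A B n x : 𝕜)) (D : 𝕜) x := by
      simpa [Function.comp_def] using
        (RCLike.ofRealCLM (K := 𝕜)).hasFDerivAt.comp_hasDerivAt x hD
    rw [((p.hasDerivAt_eval_ofReal x).fun_mul h4).deriv]
    have h5 : ((s.eval x : ℝ) : 𝕜) * (D : 𝕜) = ((s.derivative.eval x : ℝ) : 𝕜) *
        ((cutoffFamily s (fun u => u * deriv A u) B n x : 𝕜) +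
          (cutoffFamily s A (fun u => u * deriv B u) n x : 𝕜)) := by
      exact_mod_cast congrArg (RCLike.ofReal (K := 𝕜)) hsD
    simp only [Pi.add_apply, Polynomial.eval_mul, s', Polynomial.derivative_map, eval_map_ofReal]
    linear_combination p.eval (x : 𝕜) * h5

/-- Each derivative costs one factor of `s`: `(s^(j+1) E)' = s^j ((j+1) s' E + s E')`, and the
bracket stays in the span. -/
theorem deriv_pow_mul_mem_cutoffSpan {s : Polynomial ℝ} {E : ℕ → ℝ → 𝕜} (hE : E ∈ cutoffSpan 𝕜 s)
    (j : ℕ) : ∃ E' ∈ cutoffSpan 𝕜 s, ∀ n,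
      deriv (fun x => ((s.eval x : ℝ) : 𝕜) ^ (j + 1) * E n x) =
        fun x => ((s.eval x : ℝ) : 𝕜) ^ j * E' n x := by
  have h1 := eval_mul_mem_cutoffSpan hE
    (Polynomial.C ((j : 𝕜) + 1) * (s.derivative.map (algebraMap ℝ 𝕜)))
  refine ⟨_, add_mem h1 (eval_mul_deriv_mem_cutoffSpan hE), fun n => funext fun x => ?_⟩
  have hs : HasDerivAt (fun x => ((s.eval x : ℝ) : 𝕜)) ((s.derivative.eval x : ℝ) : 𝕜) x := by
    simpa [Function.comp_def] using
      (RCLike.ofRealCLM (K := 𝕜)).hasFDerivAt.comp_hasDerivAt x (s.hasDerivAt x)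
  have hE' := ((contDiff_of_mem_cutoffSpan hE n).differentiable (by simp) x).hasDerivAt
  rw [((hs.fun_pow (j + 1)).fun_mul hE').deriv]
  simp only [Pi.add_apply, Polynomial.eval_mul, Polynomial.eval_C, eval_map_ofReal]
  push_cast
  ring

theorem iteratedDeriv_pow_mul_mem_cutoffSpan {s : Polynomial ℝ} (i : ℕ) :
    ∀ {E : ℕ → ℝ → 𝕜} (_ : E ∈ cutoffSpan 𝕜 s) (j : ℕ), ∃ E' ∈ cutoffSpan 𝕜 s, ∀ n,
      iteratedDeriv i (fun x => ((s.eval x : ℝ) : 𝕜) ^ (j + i) * E n x) =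
        fun x => ((s.eval x : ℝ) : 𝕜) ^ j * E' n x := by
  induction i with
  | zero => exact fun {E} hE j => ⟨E, hE, fun n => by simp⟩
  | succ i ih =>
    intro E hE j
    obtain ⟨E₁, hE₁, h₁⟩ := deriv_pow_mul_mem_cutoffSpan hE (j + i)
    obtain ⟨E₂, hE₂, h₂⟩ := ih hE₁ j
    refine ⟨E₂, hE₂, fun n => ?_⟩
    rw [iteratedDeriv_succ', ← add_assoc, h₁, h₂]

/-- The cutoffs are bounded independently of `n`, so `E n * κ` has an integrable majorant
independent of `n`, as dominated convergence requires. -/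
theorem exists_bound_of_mem_cutoffSpan {s : Polynomial ℝ} {κ : ℝ → 𝕜}
    (hκ : ∀ p : Polynomial 𝕜, Integrable fun x : ℝ => p.eval (x : 𝕜) * κ x) {E : ℕ → ℝ → 𝕜}
    (hE : E ∈ cutoffSpan 𝕜 s) :
    ∃ b : ℝ → ℝ, Integrable b ∧ ∀ n x, ‖E n x * κ x‖ ≤ b x := by
  induction hE using Submodule.span_induction with
  | zero => exact ⟨0, integrable_zero _ _ _, fun n x => by simp⟩
  | add E F _ _ hE hF =>
    obtain ⟨b, hb, h⟩ := hE
    obtain ⟨b', hb', h'⟩ := hF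
    refine ⟨b + b', hb.add hb', fun n x => ?_⟩
    rw [Pi.add_apply, Pi.add_apply, add_mul]
    exact (norm_add_le _ _).trans (add_le_add (h n x) (h' n x))
  | smul c E _ hE =>
    obtain ⟨b, hb, h⟩ := hE
    refine ⟨fun x => ‖c‖ * b x, hb.const_mul _, fun n x => ?_⟩
    rw [Pi.smul_apply, Pi.smul_apply, smul_mul_assoc, norm_smul]
    exact mul_le_mul_of_nonneg_left (h n x) (norm_nonneg c)
  | mem E hE =>
    obtain ⟨p, A, B, hA, hB, rfl⟩ := hE
    obtain ⟨C, hC⟩ := hA.bounded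
    obtain ⟨C', hC'⟩ := hB.bounded
    refine ⟨fun x => C * C' * ‖p.eval (x : 𝕜) * κ x‖, (hκ p).norm.const_mul _, fun n x => ?_⟩
    have h0 := (abs_nonneg _).trans (hC 0)
    have h : |cutoffFamily s A B n x| ≤ C * C' := by
      rw [cutoffFamily, abs_mul]
      exact mul_le_mul (hC _) (hC' _) (abs_nonneg _) h0
    rw [mul_right_comm, norm_mul, RCLike.norm_ofReal, mul_comm]
    exact mul_le_mul_of_nonneg_right h (norm_nonneg _)

end Analysis

/-! ### Integration by parts off the singular set, and passage to the limit. -/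

section WeakEquation

variable {𝕜 : Type*} [RCLike 𝕜]

theorem ContDiffAt.iteratedDeriv_nat {f : ℝ → 𝕜} {x : ℝ} {m i : ℕ} {r : ℕ}
    (hf : ContDiffAt ℝ r f x) (h : i + m ≤ r) : ContDiffAt ℝ m (iteratedDeriv i f) x := by
  induction i generalizing m with
  | zero => simpa using hf.of_le (by exact_mod_cast (by omega : m ≤ r))
  | succ i ih =>
    have h1 : ContDiffAt ℝ ((m + 1 : ℕ) : WithTop ℕ∞) (iteratedDeriv i f) x := ih (by omega)
    rw [iteratedDeriv_succ]
    have h2 : ContDiffAt ℝ m (fderiv ℝ (iteratedDeriv i f)) x := h1.fderiv_right (by norm_cast)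
    exact h2.clm_apply contDiffAt_const

theorem continuous_mul_of_tsupport {u v : ℝ → 𝕜} (hu : Continuous u)
    (hv : ∀ x ∈ tsupport u, ContinuousAt v x) : Continuous fun x => u x * v x :=
  continuous_of_tsupport fun x hx =>
    hu.continuousAt.mul (hv x (closure_mono (Function.support_mul_subset_left u v) hx))

/-- `v` may be wild off the support of `u`, but `u * v` vanishes near every point there and so is
differentiable on the whole line. -/
theorem integral_mul_deriv_of_tsupport {u v : ℝ → 𝕜} (hu : ContDiff ℝ 1 u)
    (hc : HasCompactSupport u) (hv : ∀ x ∈ tsupport u, ContDiffAt ℝ 1 v x) :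
    ∫ x, u x * deriv v x = -∫ x, deriv u x * v x := by
  have hv' : ∀ x ∈ tsupport u, ContinuousAt (deriv v) x := fun x hx => by
    have h := (hv x hx).fderiv_right (m := 0) (by norm_num)
    exact (h.continuousAt.clm_apply continuousAt_const)
  have hsub : tsupport (deriv u) ⊆ tsupport u := tsupport_deriv_subset
  have h1 : Integrable fun x => u x * deriv v x :=
    (continuous_mul_of_tsupport hu.continuous hv').integrable_of_hasCompactSupport hc.mul_right
  have h2 : Integrable fun x => deriv u x * v x :=
    (continuous_mul_of_tsupport (hu.continuous_deriv le_rfl)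
      fun x hx => (hv x (hsub hx)).continuousAt).integrable_of_hasCompactSupport hc.deriv.mul_right
  have h3 : Integrable fun x => u x * v x :=
    (continuous_mul_of_tsupport hu.continuous
      fun x hx => (hv x hx).continuousAt).integrable_of_hasCompactSupport hc.mul_right
  have hderiv : ∀ x, HasDerivAt (fun x => u x * v x) (deriv u x * v x + u x * deriv v x) x := by
    intro x
    by_cases hx : x ∈ tsupport u
    · exact ((hu.differentiable one_ne_zero) x).hasDerivAt.mul
        ((hv x hx).differentiableAt one_ne_zero).hasDerivAt
    · have h0 : u =ᶠ[𝓝 x] 0 := notMem_tsupport_iff_eventuallyEq.1 hx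
      have h0' : deriv u x = 0 := by
        rw [h0.deriv_eq]
        exact deriv_const x 0
      have hz : (fun x => u x * v x) =ᶠ[𝓝 x] fun _ => 0 := by
        filter_upwards [h0] with y hy
        simp [hy]
      have : u x = 0 := h0.eq_of_nhds
      rw [h0', this, zero_mul, zero_mul, add_zero]
      exact (hasDerivAt_const x (0 : 𝕜)).congr_of_eventuallyEq hz
  have h := integral_eq_zero_of_hasDerivAt_of_integrable hderiv (h2.add h1) h3
  rw [integral_add h2 h1] at h
  linear_combination h

theorem integral_mul_iteratedDeriv_of_tsupport {K : ℝ → 𝕜} {r : ℕ} (i : ℕ) (hi : i ≤ r) :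
    ∀ {u : ℝ → 𝕜} (_ : ContDiff ℝ ∞ u) (_ : HasCompactSupport u)
      (_ : ∀ x ∈ tsupport u, ContDiffAt ℝ r K x),
      ∫ x, u x * iteratedDeriv i K x = (-1) ^ i * ∫ x, iteratedDeriv i u x * K x := by
  induction i with
  | zero => intros; simp
  | succ i ih =>
    intro u hu hc hK
    have hd : ContDiff ℝ ∞ (deriv u) := (contDiff_infty_iff_deriv.1 hu).2
    rw [iteratedDeriv_succ, integral_mul_deriv_of_tsupport (hu.of_le (by norm_cast)) hc fun x hx =>
        (hK x hx).iteratedDeriv_nat (m := 1) hi,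
      ih (by omega) hd hc.deriv fun x hx => hK x (tsupport_deriv_subset hx), iteratedDeriv_succ']
    ring

theorem exists_cutoff_near_zero : ∃ B : ℝ → ℝ, IsCutoff B ∧ (∀ u, |u| ≤ 1 → B u = 1) ∧
    ∀ u, 2 ≤ |u| → B u = 0 := by
  let f : ContDiffBump (0 : ℝ) := ⟨1, 2, one_pos, one_lt_two⟩
  refine ⟨f, ⟨f.contDiff, 0, by simpa using f.hasCompactSupport⟩, fun u hu => ?_, fun u hu => ?_⟩
  · exact f.one_of_mem_closedBall (by simpa [f] using hu)
  · exact f.zero_of_le_dist (by simpa [f] using hu)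

theorem exists_cutoff_away_from_zero : ∃ A : ℝ → ℝ, IsCutoff A ∧ (∀ u, |u| ≤ 1 → A u = 0) ∧
    ∀ u, 2 ≤ |u| → A u = 1 := by
  obtain ⟨B, ⟨hB, c, hc⟩, h1, h0⟩ := exists_cutoff_near_zero
  refine ⟨fun u => 1 - B u, ⟨contDiff_const.sub hB, 1 - c, ?_⟩, fun u hu => by simp [h1 u hu],
    fun u hu => by simp [h0 u hu]⟩
  have e : (fun u => 1 - B u - (1 - c)) = -fun u => B u - c := by
    ext u
    simp
  rw [e]
  exact hc.neg

/-- Smooth cutoffs with compact support off the zeros of a polynomial, exhausting their complement. -/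
theorem exists_exhausting_cutoff {s : Polynomial ℝ} (hs : 0 < s.degree) :
    ∃ A B : ℝ → ℝ, IsCutoff A ∧ IsCutoff B ∧
      (∀ n, HasCompactSupport (cutoffFamily s A B n)) ∧
      (∀ n, ∀ x ∈ tsupport (cutoffFamily s A B n), s.eval x ≠ 0) ∧
      ∀ x, s.eval x ≠ 0 → ∀ᶠ n in Filter.atTop, ∀ᶠ z in 𝓝 x, cutoffFamily s A B n z = 1 := by
  obtain ⟨A, hA, hA0, hA1⟩ := exists_cutoff_away_from_zero
  obtain ⟨B, hB, hB1, hB0⟩ := exists_cutoff_near_zero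
  have hcont : Continuous fun x => |s.eval x| := s.continuous.abs
  have hsub : ∀ n : ℕ, tsupport (cutoffFamily s A B n) ⊆
      {x | ((n : ℝ) + 1)⁻¹ ≤ |s.eval x|} ∩ {x | |s.eval x| ≤ 2 * (n + 1)} := by
    intro n
    have hn : (0 : ℝ) < n + 1 := by positivity
    refine closure_minimal ?_ ((isClosed_le continuous_const hcont).inter
      (isClosed_le hcont continuous_const))
    intro x hx
    rw [Function.mem_support, cutoffFamily] at hx
    constructor
    · by_contra h
      have h' : |s.eval x| < ((n : ℝ) + 1)⁻¹ := lt_of_not_ge h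
      have h1 := mul_lt_mul_of_pos_left h' hn
      rw [mul_inv_cancel₀ hn.ne'] at h1
      rw [hA0 _ (by rw [abs_mul, abs_of_pos hn]; exact h1.le), zero_mul] at hx
      exact hx rfl
    · by_contra h
      have h' : 2 * ((n : ℝ) + 1) < |s.eval x| := lt_of_not_ge h
      refine hx ?_
      rw [hB0, mul_zero]
      rw [abs_mul, abs_of_pos (inv_pos.2 hn), le_inv_mul_iff₀ hn, mul_comm]
      exact h'.le
  refine ⟨A, B, hA, hB, fun n => ?_, fun n x hx h0 => ?_, fun x hx => ?_⟩
  · have ht := s.tendsto_norm_atTop hs (tendsto_norm_cocompact_atTop (E := ℝ))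
    have hev := ht.eventually_gt_atTop (2 * ((n : ℝ) + 1))
    obtain ⟨t, ht, hts⟩ := Filter.mem_cocompact.1 hev
    refine HasCompactSupport.intro' ht ht.isClosed fun x hx => ?_
    by_contra h
    have h1 := (hsub n (subset_closure h)).2
    have h2 : 2 * ((n : ℝ) + 1) < ‖s.eval x‖ := hts hx
    rw [Real.norm_eq_abs] at h2
    exact absurd h1 (not_le.2 h2)
  · have h1 : ((n : ℝ) + 1)⁻¹ ≤ |s.eval x| := (hsub n hx).1
    rw [h0, abs_zero] at h1
    have : (0 : ℝ) < (n + 1 : ℝ)⁻¹ := by positivity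
    linarith
  · obtain ⟨n₀, hn₀⟩ := exists_nat_gt (|s.eval x| + 2 / |s.eval x|)
    have hpos : 0 < |s.eval x| := abs_pos.2 hx
    filter_upwards [Filter.eventually_ge_atTop n₀] with n hn
    have hn' : (n₀ : ℝ) ≤ n := by exact_mod_cast hn
    have hn1 : (0 : ℝ) < n + 1 := by positivity
    have h1 : |s.eval x| < n + 1 := by
      have : 0 < 2 / |s.eval x| := by positivity
      linarith
    have h2 : 2 / (n + 1) < |s.eval x| := by
      rw [div_lt_iff₀ hn1, mul_comm, ← div_lt_iff₀ hpos]
      linarith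
    filter_upwards [hcont.continuousAt.eventually_lt continuousAt_const h1,
      continuousAt_const.eventually_lt hcont.continuousAt h2] with z hz1 hz2
    rw [cutoffFamily, hA1, hB1, one_mul]
    · rw [abs_mul, abs_of_pos (inv_pos.2 hn1), inv_mul_le_iff₀ hn1, mul_one]
      exact hz1.le
    · rw [abs_mul, abs_of_pos hn1, mul_comm, ← div_le_iff₀ hn1]
      exact hz2.le

theorem ae_eval_ne_zero {s : Polynomial ℝ} (hs : s ≠ 0) : ∀ᵐ x : ℝ, s.eval x ≠ 0 := by
  have h : volume (s.rootSet ℝ) = 0 := (s.rootSet_finite ℝ).measure_zero _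
  filter_upwards [measure_eq_zero_iff_ae_notMem.1 h] with x hx h0
  exact hx ((Polynomial.mem_rootSet).2 ⟨hs, by simpa using h0⟩)

/-- Passing to the limit in `∫ (s^(r+1) q η)^(i) K` along exhausting cutoffs `η`. -/
theorem tendsto_integral_iteratedDeriv {s : Polynomial ℝ} (hs : 0 < s.degree) {K : ℝ → 𝕜}
    (hK : ∀ p : Polynomial 𝕜, Integrable fun x : ℝ =>
      p.eval (x : 𝕜) * (((s.eval x : ℝ) : 𝕜) * K x)) {A B : ℝ → ℝ} (hA : IsCutoff A)
    (hB : IsCutoff B)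
    (hlim : ∀ x, s.eval x ≠ 0 →
      ∀ᶠ n in Filter.atTop, ∀ᶠ z in 𝓝 x, cutoffFamily s A B n z = 1)
    {i r : ℕ} (hi : i ≤ r) (q : Polynomial 𝕜) :
    Integrable (fun x : ℝ => (Polynomial.derivative^[i]
        (s.map (algebraMap ℝ 𝕜) ^ (r + 1) * q)).eval (x : 𝕜) * K x) ∧
    Filter.Tendsto (fun n => ∫ x, iteratedDeriv i (fun x : ℝ => ((s.eval x : ℝ) : 𝕜) ^ (r + 1) *
        (q.eval (x : 𝕜) * (cutoffFamily s A B n x : 𝕜))) x * K x) Filter.atTop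
      (𝓝 (∫ x : ℝ, (Polynomial.derivative^[i]
        (s.map (algebraMap ℝ 𝕜) ^ (r + 1) * q)).eval (x : 𝕜) * K x)) := by
  -- With `r = j + i`, the power `s^(r+1)` pays for `i` derivatives and leaves `s^(j+1)`; one of
  -- those factors joins `K`, because only `s * K` is assumed integrable against polynomials.
  obtain ⟨j, rfl⟩ := Nat.exists_eq_add_of_le' hi
  set s' : Polynomial 𝕜 := s.map (algebraMap ℝ 𝕜)
  have hs0 : s ≠ 0 := by
    rintro rfl
    simp at hs
  obtain ⟨E, hE, hEeq⟩ := iteratedDeriv_pow_mul_mem_cutoffSpan i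
    (eval_mul_cutoffFamily_mem s q hA hB) (j + 1)
  have hE' := eval_mul_mem_cutoffSpan hE (s' ^ j)
  have hrw : ∀ n x, iteratedDeriv i (fun x : ℝ => ((s.eval x : ℝ) : 𝕜) ^ (j + i + 1) *
      (q.eval (x : 𝕜) * (cutoffFamily s A B n x : 𝕜))) x * K x =
      ((s' ^ j).eval (x : 𝕜) * E n x) * (((s.eval x : ℝ) : 𝕜) * K x) := by
    intro n x
    rw [show j + i + 1 = j + 1 + i by ring, hEeq, Polynomial.eval_pow, eval_map_ofReal]
    ring
  simp only [hrw]
  obtain ⟨b, hb, hbound⟩ := exists_bound_of_mem_cutoffSpan hK hE'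
  have hmeas : AEStronglyMeasurable (fun x : ℝ => ((s.eval x : ℝ) : 𝕜) * K x) volume := by
    simpa using (hK 1).aestronglyMeasurable
  have hF : ∀ n, AEStronglyMeasurable (fun x : ℝ =>
      ((s' ^ j).eval (x : 𝕜) * E n x) * (((s.eval x : ℝ) : 𝕜) * K x)) volume := fun n =>
    (contDiff_of_mem_cutoffSpan hE' n).continuous.aestronglyMeasurable.mul hmeas
  have hpt : ∀ᵐ x : ℝ, Filter.Tendsto
      (fun n => ((s' ^ j).eval (x : 𝕜) * E n x) * (((s.eval x : ℝ) : 𝕜) * K x)) Filter.atTop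
      (𝓝 ((Polynomial.derivative^[i] (s' ^ (j + i + 1) * q)).eval (x : 𝕜) * K x)) := by
    filter_upwards [ae_eval_ne_zero hs0] with x hx
    refine tendsto_const_nhds.congr' ?_
    filter_upwards [hlim x hx] with n hn
    rw [← hrw]
    congr 1
    have := congrFun (Polynomial.iteratedDeriv_eval_ofReal (s' ^ (j + i + 1) * q) i) x
    rw [← this]
    refine Filter.EventuallyEq.iteratedDeriv_eq i ?_
    filter_upwards [hn] with z hz
    rw [hz, Polynomial.eval_mul, Polynomial.eval_pow, eval_map_ofReal]
    simp
  refine ⟨?_, tendsto_integral_of_dominated_convergence b hF hb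
    (fun n => Filter.Eventually.of_forall (hbound n)) hpt⟩
  refine hb.mono' (aestronglyMeasurable_of_tendsto_ae Filter.atTop hF hpt) ?_
  filter_upwards [hpt] with x hx
  exact le_of_tendsto hx.norm (Filter.Eventually.of_forall fun n => hbound n x)

/-- A function satisfying a linear differential equation with polynomial coefficients away from the
zeros of a polynomial `s` satisfies it in the weak sense, against polynomial multiples of a high
power of `s`, without boundary terms. -/
theorem integral_adjoint_eq_zero {s : Polynomial ℝ} (hs : 0 < s.degree) {K : ℝ → 𝕜} {r : ℕ}
    {c : ℕ → Polynomial 𝕜}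
    (hode : ∀ x, s.eval x ≠ 0 → ContDiffAt ℝ r K x ∧
      ∑ i ∈ Finset.range (r + 1), (c i).eval (x : 𝕜) * iteratedDeriv i K x = 0)
    (hK : ∀ p : Polynomial 𝕜, Integrable fun x : ℝ =>
      p.eval (x : 𝕜) * (((s.eval x : ℝ) : 𝕜) * K x)) (q : Polynomial 𝕜) :
    (∀ i ≤ r, Integrable fun x : ℝ => (Polynomial.derivative^[i]
      (s.map (algebraMap ℝ 𝕜) ^ (r + 1) * (c i * q))).eval (x : 𝕜) * K x) ∧
    ∑ i ∈ Finset.range (r + 1), (-1) ^ i * ∫ x : ℝ, (Polynomial.derivative^[i]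
      (s.map (algebraMap ℝ 𝕜) ^ (r + 1) * (c i * q))).eval (x : 𝕜) * K x = 0 := by
  obtain ⟨A, B, hA, hB, hcs, hsupp, hlim⟩ := exists_exhausting_cutoff hs
  refine ⟨fun i hi => (tendsto_integral_iteratedDeriv hs hK hA hB hlim hi (c i * q)).1, ?_⟩
  have hT := tendsto_finsetSum (Finset.range (r + 1)) fun i hi =>
    (tendsto_integral_iteratedDeriv hs hK hA hB hlim
      (Nat.lt_succ_iff.1 (Finset.mem_range.1 hi)) (c i * q)).2.const_mul ((-1 : 𝕜) ^ i)
  -- For each fixed `n` the sum is already zero: the test functions have compact support where `K`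
  -- is smooth, so parts bring back the differential equation.
  refine tendsto_nhds_unique hT (tendsto_const_nhds.congr fun n => ?_)
  set η := fun x => (cutoffFamily s A B n x : 𝕜)
  have hη : ContDiff ℝ ∞ η :=
    (RCLike.ofRealCLM (K := 𝕜)).contDiff.comp (contDiff_cutoffFamily s hA hB n)
  have hη0 : Function.support η = Function.support (cutoffFamily s A B n) := by
    ext x
    simp [η]
  have hηt : tsupport η = tsupport (cutoffFamily s A B n) := by
    rw [tsupport, tsupport, hη0]
  have hηc : HasCompactSupport η := by
    rw [HasCompactSupport, hηt]
    exact hcs n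
  let u : ℕ → ℝ → 𝕜 := fun i x =>
    ((s.eval x : ℝ) : 𝕜) ^ (r + 1) * ((c i * q).eval (x : 𝕜) * η x)
  have hu : ∀ i, ContDiff ℝ ∞ (u i) := fun i =>
    (((RCLike.ofRealCLM (K := 𝕜)).contDiff.comp s.contDiff_eval).pow (r + 1)).mul
      ((c i * q).contDiff_eval_ofReal.mul hη)
  have huc : ∀ i, HasCompactSupport (u i) := fun i => (hηc.mul_left).mul_left
  have hut : ∀ i, ∀ x ∈ tsupport (u i), ContDiffAt ℝ r K x := by
    intro i x hx
    refine (hode x (hsupp n x ?_)).1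
    rw [← hηt]
    refine closure_mono (fun z hz => ?_) hx
    rw [Function.mem_support] at hz ⊢
    intro h
    simp [u, h] at hz
  symm
  calc ∑ i ∈ Finset.range (r + 1), (-1 : 𝕜) ^ i * ∫ x, iteratedDeriv i (u i) x * K x
      = ∑ i ∈ Finset.range (r + 1), ∫ x, u i x * iteratedDeriv i K x :=
        Finset.sum_congr rfl fun i hi => (integral_mul_iteratedDeriv_of_tsupport i
          (Nat.lt_succ_iff.1 (Finset.mem_range.1 hi)) (hu i) (huc i) (hut i)).symm
    _ = ∫ x, ∑ i ∈ Finset.range (r + 1), u i x * iteratedDeriv i K x := by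
        refine (integral_finsetSum _ fun i hi => ?_).symm
        have hi' := Nat.lt_succ_iff.1 (Finset.mem_range.1 hi)
        exact (continuous_mul_of_tsupport (hu i).continuous fun x hx =>
          ((hut i x hx).iteratedDeriv_nat (m := 0) hi').continuousAt).integrable_of_hasCompactSupport
            (huc i).mul_right
    _ = ∫ _, 0 := by
        congr 1
        ext x
        by_cases hx : s.eval x = 0
        · simp [u, hx]
        · have h := (hode x hx).2
          calc _ = ((s.eval x : ℝ) : 𝕜) ^ (r + 1) * (q.eval (x : 𝕜) * η x) *
              ∑ i ∈ Finset.range (r + 1), (c i).eval (x : 𝕜) * iteratedDeriv i K x := by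
                rw [Finset.mul_sum]
                refine Finset.sum_congr rfl fun i _ => ?_
                simp only [u, Polynomial.eval_mul]
                ring
            _ = 0 := by rw [h, mul_zero]
    _ = 0 := integral_zero _ _

end WeakEquation

/-! ### The moment functional and its annihilating operator. -/

section MainTheorem

variable {𝕜 : Type*} [RCLike 𝕜]

/-- A nonzero polynomial over `𝕜` has a nonzero multiple with real coefficients. -/
theorem exists_dvd_map_ofReal {g : Polynomial 𝕜} (hg : g ≠ 0) :
    ∃ s : Polynomial ℝ, s ≠ 0 ∧ g ∣ s.map (algebraMap ℝ 𝕜) := by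
  obtain ⟨u, v, huv⟩ : ∃ u v : Polynomial ℝ, g = u.map (algebraMap ℝ 𝕜) +
      Polynomial.C RCLike.I * v.map (algebraMap ℝ 𝕜) := by
    clear hg
    induction g using Polynomial.induction_on' with
    | add p q hp hq =>
      obtain ⟨u, v, rfl⟩ := hp
      obtain ⟨u', v', rfl⟩ := hq
      refine ⟨u + u', v + v', ?_⟩
      simp only [Polynomial.map_add]
      ring
    | monomial n a =>
      refine ⟨Polynomial.monomial n (RCLike.re a), Polynomial.monomial n (RCLike.im a), ?_⟩
      rw [Polynomial.map_monomial, Polynomial.map_monomial, Polynomial.C_mul_monomial, ← map_add]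
      congr 1
      conv_lhs => rw [← RCLike.re_add_im a]
      rw [mul_comm]
  -- Either `I = 0` and `g` is the real polynomial `u`, or `g` divides `g * conj g = u ^ 2 + v ^ 2`.
  -- A real multiple is needed because the cutoffs are functions of a real argument.
  rcases RCLike.I_mul_I (K := 𝕜) with hI | hI
  · refine ⟨u, ?_, by rw [huv, hI]; simp⟩
    rintro rfl
    exact hg (by rw [huv, hI]; simp)
  · have hC : (Polynomial.C (RCLike.I : 𝕜)) * Polynomial.C RCLike.I = -1 := by
      rw [← map_mul, hI, map_neg, map_one]
    refine ⟨u ^ 2 + v ^ 2, fun h => hg ?_,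
      u.map (algebraMap ℝ 𝕜) - Polynomial.C RCLike.I * v.map (algebraMap ℝ 𝕜), ?_⟩
    · have hz : ∀ x, u.eval x = 0 ∧ v.eval x = 0 := by
        intro x
        have hx := congrArg (Polynomial.eval x) h
        simp only [Polynomial.eval_add, Polynomial.eval_pow, Polynomial.eval_zero] at hx
        constructor <;> nlinarith [sq_nonneg (u.eval x), sq_nonneg (v.eval x)]
      have hu : u = 0 := Polynomial.funext fun x => by simpa using (hz x).1
      have hv : v = 0 := Polynomial.funext fun x => by simpa using (hz x).2
      rw [huv, hu, hv]
      simp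
    · rw [huv]
      simp only [Polynomial.map_add, Polynomial.map_pow]
      linear_combination v.map (algebraMap ℝ 𝕜) ^ 2 * hC

theorem isOpen_realInterval (α β : EReal) : IsOpen (realInterval α β) :=
  (isOpen_lt continuous_const continuous_coe_real_ereal).inter
    (isOpen_lt continuous_coe_real_ereal continuous_const)

theorem eventually_notMem_realInterval {α β : EReal} {x : ℝ} (hα : x ≠ α.toReal)
    (hβ : x ≠ β.toReal) (hx : x ∉ realInterval α β) : ∀ᶠ z in 𝓝 x, z ∉ realInterval α β := by
  have h1 : ∀ {γ : EReal}, x ≠ γ.toReal → (x : EReal) ≠ γ := by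
    rintro γ h rfl
    exact h (EReal.toReal_coe x).symm
  have h2 : (x : EReal) < α ∨ β < (x : EReal) := by
    by_contra h
    push Not at h
    exact hx ⟨lt_of_le_of_ne h.1 (h1 hα).symm, lt_of_le_of_ne h.2 (h1 hβ)⟩
  rcases h2 with h | h
  · filter_upwards [continuous_coe_real_ereal.continuousAt.eventually_lt continuousAt_const h]
      with z hz hz'
    exact lt_asymm hz hz'.1
  · filter_upwards [continuousAt_const.eventually_lt continuous_coe_real_ereal.continuousAt h]
      with z hz hz'
    exact lt_asymm hz hz'.2

/-- The extension by zero of a solution on an interval is a solution off the endpoints. -/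
theorem indicator_ode {α β : EReal} {K : ℝ → 𝕜} {r : ℕ} {c : ℕ → Polynomial 𝕜}
    (hode : ∀ x ∈ realInterval α β, (c r).eval (x : 𝕜) ≠ 0 → ContDiffAt ℝ r K x ∧
        ∑ i ∈ Finset.range (r + 1), (c i).eval (x : 𝕜) * iteratedDeriv i K x = 0)
    {x : ℝ} (hα : x ≠ α.toReal) (hβ : x ≠ β.toReal) (hc : (c r).eval (x : 𝕜) ≠ 0) :
    ContDiffAt ℝ r ((realInterval α β).indicator K) x ∧
      ∑ i ∈ Finset.range (r + 1), (c i).eval (x : 𝕜) *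
        iteratedDeriv i ((realInterval α β).indicator K) x = 0 := by
  by_cases hx : x ∈ realInterval α β
  · have h : (realInterval α β).indicator K =ᶠ[𝓝 x] K := by
      filter_upwards [(isOpen_realInterval α β).mem_nhds hx] with z hz
      exact Set.indicator_of_mem hz K
    obtain ⟨h1, h2⟩ := hode x hx hc
    refine ⟨h1.congr_of_eventuallyEq h, ?_⟩
    simpa only [h.iteratedDeriv_eq] using h2
  · have h : (realInterval α β).indicator K =ᶠ[𝓝 x] fun _ => 0 := by
      filter_upwards [eventually_notMem_realInterval hα hβ hx] with z hz
      exact Set.indicator_of_notMem hz K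
    refine ⟨contDiffAt_const.congr_of_eventuallyEq h, Finset.sum_eq_zero fun i _ => ?_⟩
    rw [h.iteratedDeriv_eq, iteratedDeriv_const]
    simp

/-- The polynomials whose product with `K` is integrable on `I`. -/
def integrablePolynomials (K : ℝ → 𝕜) (I : Set ℝ) : Submodule 𝕜 (Polynomial 𝕜) where
  carrier := {q | IntegrableOn (fun x : ℝ => q.eval (x : 𝕜) * K x) I}
  zero_mem' := by simp
  add_mem' := by
    intro p q hp hq
    simpa [IntegrableOn, add_mul, Pi.add_def] using Integrable.add hp hq
  smul_mem' := by
    intro e p hp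
    have := hp.const_mul e
    simpa [IntegrableOn, mul_assoc] using this

/-- The integral is linear on the subspace of integrable polynomials and is extended arbitrarily to
all of `𝕜[x]`, which makes `M` total without further integrability assumptions. -/
theorem exists_moment_functional (K : ℝ → 𝕜) (I : Set ℝ) :
    ∃ M : Polynomial 𝕜 →ₗ[𝕜] 𝕜, ∀ q ∈ integrablePolynomials K I,
      M q = ∫ x in I, q.eval (x : 𝕜) * K x := by
  let M₀ : integrablePolynomials K I →ₗ[𝕜] 𝕜 :=
    { toFun := fun q => ∫ x in I, (q : Polynomial 𝕜).eval (x : 𝕜) * K x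
      map_add' := fun p q => by
        rw [← integral_add p.2 q.2]
        simp [add_mul]
      map_smul' := fun e p => by
        rw [RingHom.id_apply, smul_eq_mul, ← integral_const_mul]
        simp [mul_assoc] }
  obtain ⟨M, hM⟩ := M₀.exists_extend
  exact ⟨M, fun q hq => LinearMap.congr_fun hM ⟨q, hq⟩⟩

/-- If the degrees of the polynomials `P n` are unbounded and all `P n * K` are integrable, so are
the products of `K` with the polynomials in the ideal generated by the `P n`. -/
theorem mem_integrablePolynomials_of_mem_span {K : ℝ → 𝕜} {I : Set ℝ}
    {P : ℕ → Polynomial 𝕜} (hP : ∀ n, P n ∈ integrablePolynomials K I)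
    (hdeg : ∀ D, ∃ n, D < (P n).natDegree) {q : Polynomial 𝕜}
    (hq : q ∈ Ideal.span (Set.range P)) : q ∈ integrablePolynomials K I := by
  suffices h : ∀ (u : Polynomial 𝕜) (n : ℕ), u * P n ∈ integrablePolynomials K I by
    have h' : ∀ u : Polynomial 𝕜, u * q ∈ integrablePolynomials K I := by
      induction hq using Submodule.span_induction with
      | zero => simp
      | add x y _ _ hx hy => exact fun u => mul_add u x y ▸ add_mem (hx u) (hy u)
      | mem x hx =>
        obtain ⟨n, rfl⟩ := hx
        exact fun u => h u n
      | smul v x _ hx => exact fun u => by simpa [mul_assoc] using hx (u * v)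
    simpa using h' 1
  intro u n
  -- Outside a compact set `u * P n` is dominated by a multiple of the higher-degree `P m`; inside
  -- it `u` is bounded, so `P n` dominates. No local bound on `K` is used.
  obtain ⟨m, hm⟩ := hdeg (u * P n).natDegree
  have hO := (Polynomial.isBigO_cobounded_of_degree_le (R := 𝕜) (P := u * P n) (Q := P m)
    (Polynomial.degree_lt_degree hm).le).comp_tendsto
    (RCLike.tendsto_ofReal_cobounded_cobounded 𝕜)
  obtain ⟨C, hC⟩ := hO.bound
  rw [Metric.cobounded_eq_cocompact] at hC
  obtain ⟨t, ht, hts⟩ := Filter.mem_cocompact.1 hC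
  obtain ⟨C', hC'⟩ := ht.exists_bound_of_continuousOn
    u.contDiff_eval_ofReal.continuous.continuousOn
  have hm' : Integrable (fun x : ℝ => (P m).eval (x : 𝕜) * K x) (volume.restrict I) := hP m
  have hn' : Integrable (fun x : ℝ => (P n).eval (x : 𝕜) * K x) (volume.restrict I) := hP n
  have heq : ∀ x : ℝ, (u * P n).eval (x : 𝕜) * K x =
      u.eval (x : 𝕜) * ((P n).eval (x : 𝕜) * K x) := fun x => by
    rw [Polynomial.eval_mul, mul_assoc]
  refine Integrable.mono' ((hm'.norm.const_mul |C|).add (hn'.norm.const_mul |C'|)) ?_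
    (Filter.Eventually.of_forall fun x => ?_)
  · simp only [heq]
    exact u.contDiff_eval_ofReal.continuous.aestronglyMeasurable.mul hn'.aestronglyMeasurable
  · rw [Pi.add_apply]
    by_cases hx : x ∈ t
    · have h1 : ‖u.eval (x : 𝕜)‖ ≤ |C'| := (hC' x hx).trans (le_abs_self _)
      rw [heq, norm_mul]
      have := mul_le_mul_of_nonneg_right h1 (norm_nonneg ((P n).eval (x : 𝕜) * K x))
      have : 0 ≤ |C| * ‖(P m).eval (x : 𝕜) * K x‖ := by positivity
      linarith
    · have h1 : ‖(u * P n).eval (x : 𝕜)‖ ≤ C * ‖(P m).eval (x : 𝕜)‖ := hts hx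
      have h2 : C * ‖(P m).eval (x : 𝕜)‖ ≤ |C| * ‖(P m).eval (x : 𝕜)‖ :=
        mul_le_mul_of_nonneg_right (le_abs_self C) (norm_nonneg _)
      rw [norm_mul, norm_mul, ← mul_assoc]
      have := mul_le_mul_of_nonneg_right (h1.trans h2) (norm_nonneg (K x))
      have : 0 ≤ |C'| * ‖(P n).eval (x : 𝕜) * K x‖ := by positivity
      linarith

/-- Reduction modulo `X ^ (D + 1)` fixes every `P n` and kills all multiples of `X ^ (D + 1)`. This
covers bounded degrees, where higher moments of `K` may diverge; the operator then has order zero.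
-/
theorem exists_functional_of_bounded {P : ℕ → Polynomial 𝕜} {D : ℕ}
    (hD : ∀ n, (P n).natDegree ≤ D) (M₀ : Polynomial 𝕜 →ₗ[𝕜] 𝕜) :
    ∃ M : Polynomial 𝕜 →ₗ[𝕜] 𝕜, (∀ n, M (P n) = M₀ (P n)) ∧
      ∀ q, M (Polynomial.X ^ (D + 1) * q) = 0 := by
  have hmonic : (Polynomial.X ^ (D + 1) : Polynomial 𝕜).Monic := Polynomial.monic_X_pow _
  refine ⟨M₀ ∘ₗ Polynomial.modByMonicHom (Polynomial.X ^ (D + 1)), fun n => ?_, fun q => ?_⟩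
  · rw [LinearMap.comp_apply, Polynomial.modByMonicHom_apply,
      (Polynomial.modByMonic_eq_self_iff hmonic).2]
    rw [Polynomial.degree_X_pow]
    exact Polynomial.degree_le_natDegree.trans_lt (by exact_mod_cast Nat.lt_succ_iff.2 (hD n))
  · rw [LinearMap.comp_apply, Polynomial.modByMonicHom_apply,
      (Polynomial.modByMonic_eq_zero_iff_dvd hmonic).2 (dvd_mul_right _ _), map_zero]

/-- The moment functional kills the image of a nonzero differential operator. -/
theorem exists_annihilated_functional {α β : EReal} {P : ℕ → Polynomial 𝕜} {K : ℝ → 𝕜}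
    (hK : IsHolonomicOn K (realInterval α β))
    (hint : ∀ n, P n ∈ integrablePolynomials K (realInterval α β)) :
    ∃ (M : Polynomial 𝕜 →ₗ[𝕜] 𝕜) (r : ℕ) (c : ℕ → Polynomial 𝕜), c r ≠ 0 ∧
      (∀ n, M (P n) = ∫ x in realInterval α β, (P n).eval (x : 𝕜) * K x) ∧
      ∀ q, M (∑ i ∈ Finset.range (r + 1), Polynomial.derivative^[i] (c i * q)) = 0 := by
  obtain ⟨M, hM⟩ := exists_moment_functional K (realInterval α β)
  by_cases hdeg : ∃ D, ∀ n, (P n).natDegree ≤ D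
  · obtain ⟨D, hD⟩ := hdeg
    obtain ⟨M', hM', hX⟩ := exists_functional_of_bounded hD M
    refine ⟨M', 0, fun _ => Polynomial.X ^ (D + 1), pow_ne_zero _ Polynomial.X_ne_zero,
      fun n => (hM' n).trans (hM _ (hint n)), fun q => ?_⟩
    simpa using hX q
  push Not at hdeg
  obtain ⟨r, c, hc, hode⟩ := hK
  set I := realInterval α β
  have hI : MeasurableSet I := (isOpen_realInterval α β).measurableSet
  obtain ⟨m, hm⟩ := hdeg 0
  have hPm : P m ≠ 0 := by
    intro h
    simp [h] at hm
  obtain ⟨s₀, hs₀, hdvd⟩ := exists_dvd_map_ofReal (mul_ne_zero hPm hc)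
  -- The factor `s₀` contains `P m`, for integrability, and `c r`, for the equation. The linear
  -- factors remove the endpoints and make `s` nonconstant; an infinite endpoint has `toReal = 0`
  -- and only adds a harmless root at 0.
  set s : Polynomial ℝ :=
    s₀ * ((Polynomial.X - Polynomial.C α.toReal) * (Polynomial.X - Polynomial.C β.toReal))
  have hs : 0 < s.degree := by
    rw [Polynomial.degree_mul, Polynomial.degree_mul, Polynomial.degree_X_sub_C,
      Polynomial.degree_X_sub_C, Polynomial.degree_eq_natDegree hs₀]
    norm_cast
    omega
  set s' : Polynomial 𝕜 := s.map (algebraMap ℝ 𝕜)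
  have hs' : s' ≠ 0 := by
    rw [Polynomial.map_ne_zero_iff (algebraMap ℝ 𝕜).injective]
    rintro h
    simp [h] at hs
  have hdvd' : P m * c r ∣ s' := by
    simp only [s', s, Polynomial.map_mul]
    exact hdvd.mul_right _
  have hmem : ∀ p : Polynomial 𝕜, s' * p ∈ integrablePolynomials K I := fun p =>
    mem_integrablePolynomials_of_mem_span hint hdeg (Ideal.mul_mem_right _ _
      (Ideal.mem_of_dvd _ ((dvd_mul_right _ _).trans hdvd') (Ideal.subset_span ⟨m, rfl⟩)))
  set K₀ := I.indicator K
  have hind : ∀ p : Polynomial 𝕜, (fun x : ℝ => p.eval (x : 𝕜) * K₀ x) =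
      I.indicator fun x => p.eval (x : 𝕜) * K x := fun p => by
    ext x
    by_cases hx : x ∈ I <;> simp [K₀, hx]
  have hweak := integral_adjoint_eq_zero (s := s) hs (K := K₀) (r := r) (c := c)
    (fun x hx => by
      refine indicator_ode hode ?_ ?_ ?_
      · rintro rfl
        simp [s] at hx
      · rintro rfl
        simp [s] at hx
      · intro h0
        have h1 := Polynomial.eval_dvd (x := (x : 𝕜)) hdvd'
        rw [Polynomial.eval_mul, h0, mul_zero, zero_dvd_iff, eval_map_ofReal] at h1
        exact hx (by exact_mod_cast h1))
    (fun p => by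
      have h1 := (integrable_indicator_iff hI).2 (hmem p)
      rw [← hind] at h1
      refine h1.congr (Filter.Eventually.of_forall fun x => ?_)
      simp only [Polynomial.eval_mul, s', eval_map_ofReal]
      ring)
  -- The adjoint of the equation multiplied by `s' ^ (r + 1)`, the signs coming from integration by
  -- parts.
  refine ⟨M, r, fun i => Polynomial.C ((-1) ^ i) * (s' ^ (r + 1) * c i), ?_,
    fun n => hM _ (hint n), fun q => ?_⟩
  · exact mul_ne_zero (by simp) (mul_ne_zero (pow_ne_zero _ hs') hc)
  · obtain ⟨h1, h2⟩ := hweak q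
    rw [map_sum, ← h2]
    refine Finset.sum_congr rfl fun i hi => ?_
    have hi' := Nat.lt_succ_iff.1 (Finset.mem_range.1 hi)
    have h3 := h1 i hi'
    rw [hind, integrable_indicator_iff hI] at h3
    rw [mul_assoc, Polynomial.iterate_derivative_C_mul, ← Polynomial.smul_eq_C_mul, map_smul,
      smul_eq_mul, mul_assoc, hM _ h3, hind, integral_indicator hI]

end MainTheorem

theorem mainTheorem1 {𝕜 : Type*} [RCLike 𝕜] (α β : EReal) (hαβ : α < β)
    (P : ℕ → Polynomial 𝕜) (hP : IsCFinite P)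
    (K : ℝ → 𝕜) (hK : IsHolonomicOn K (realInterval α β))
    (hint : ∀ n, IntegrableOn (fun x : ℝ => (P n).eval (x : 𝕜) * K x) (realInterval α β) volume)
    (a : ℕ → 𝕜)
    (ha : ∀ n, a n = ∫ x in realInterval α β, (P n).eval (x : 𝕜) * K x) :
    SatisfiesInhomogeneousODE (PowerSeries.mk a) ∧ IsPRecursive a := by
  obtain ⟨M, r, c, hc, hM, hA⟩ := exists_annihilated_functional hK hint
  obtain ⟨y, e, he, h⟩ := hP.exists_diffOp M hc hA
  have hMa : (fun n => M (P n)) = a := funext fun n => (hM n).trans (ha n).symm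
  rw [hMa] at h
  exact ⟨satisfiesInhomogeneousODE_of_diffOp he h, isPRecursive_of_diffOp he h⟩
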